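/- Let $0<\mu\le 1$ and $\kappa>0$. Let $\Psi:[0,\infty)\to\mathbb{R}$ be continuous with $\Psi(0)=0$, continuously differentiable on $(0,\infty)$ with $\Psi'(t)>0$ for all $t>0$. For $\alpha>0$ let $$(I^{\alpha}_{\Psi}g)(t)=\frac{1}{\Gamma(\alpha)}\int_0^t(\Psi(t)-\Psi(s))^{\alpha-1}\Psi'(s)g(s)\,ds,\qquad I^0_\Psi g=g,$$ and let $$D^{\mu}_{\Psi}g=\Big(\frac{1}{\Psi'(t)}\frac{d}{dt}\Big)^{m}I^{m-\mu}_{\Psi}g,\qquad m=\lfloor\mu\rfloor+1,$$ be the $\Psi$-Riemann--Liouville derivative. Let $W(z,\lambda,\nu)=\sum_{j\ge0}\frac{z^j}{j!\,\Gamma(\lambda j+\nu)}$ be the Wright function (with $1/\Gamma=0$ at the poles of $\Gamma$) and $$G(x,t)=\frac{1}{2\sqrt{\kappa}}\,\Psi(t)^{\frac{\mu}{2}-1}\,W\Big(-\frac{|x|}{\sqrt{\kappa}\,\Psi(t)^{\mu/2}},-\frac{\mu}{2},\frac{\mu}{2}\Big)\qquad(x\in\mathbb{R},\ t>0).$$ Let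 $f:\mathbb{R}\to\mathbb{R}$ be continuous with $\int_x^{x+1}|f(\eta)|\,d\eta\to0$ as $|x|\to\infty$ (for instance, $f$ continuous and integrable, or continuous and vanishing at infinity). Then the series defining $W(z,-\frac{\mu}{2},\frac{\mu}{2})$ converges absolutely for all real $z$, the integral $$u(x,t)=\int_{-\infty}^{\infty}G(x-\eta,t)f(\eta)\,d\eta$$ converges absolutely for all $x\in\mathbb{R}$, $t>0$, and $u$ is a classical solution of the problem $$D^{\mu}_{\Psi}u(x,t)=\kappa\,\frac{\partial^2u}{\partial x^2}(x,t)\quad(x\in\mathbb{R},\ t>0),$$ $$u(x,t)\to0\ \text{ as }|x|\to\infty\quad(t>0),\qquad \lim_{t\to0^+}(I^{1-\mu}_{\Psi}u)(x,t)=f(x)\quad(x\in\mathbb{R}),$$ where the operators $D^\mu_\Psi$ and $I^{1-\mu}_\Psi$ act in $t$. Here "classical" means that, for each $x\in\mathbb{R}$ and $t>0$, the integral $(I^{m-\mu}_\Psi u)(x,t)$ converges absolutely and the $m$ successive differentiations in $D^\mu_\Psi u(x,t)$ exist, and that $u(\cdot,t)$ is twice continuously differentiable for each $t>0$. -/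

import Mathlib

open Filter Topology MeasureTheory Set

noncomputable section

namespace PsiFractional

/-- The Wright function `W(z, μ, ν) = ∑ z ^ j / (j! Γ(μ j + ν))` for real arguments. As usual, `1 / Γ`
is read as `0` at the poles of `Γ`; this is what `Real.Gamma (-n) = 0` and `x / 0 = 0` give. -/
def wright (z μ ν : ℝ) : ℝ :=
  ∑' j : ℕ, z ^ j / ((j.factorial : ℝ) * Real.Gamma (μ * j + ν))

/-- The integrand of the `Ψ`-Riemann–Liouville integral of order `α` at `t`, as a function of `s`. -/
def psiIntegrand (Ψ : ℝ → ℝ) (α : ℝ) (g : ℝ → ℝ) (t s : ℝ) : ℝ :=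
  (Ψ t - Ψ s) ^ (α - 1) * deriv Ψ s * g s

/-- The `Ψ`-Riemann–Liouville fractional integral of order `α ≥ 0` with lower limit `a`;
the integral of order `0` is the identity operator. -/
def psiIntegral (a : ℝ) (Ψ : ℝ → ℝ) (α : ℝ) (g : ℝ → ℝ) (t : ℝ) : ℝ :=
  if α = 0 then g t
  else 1 / Real.Gamma α * ∫ s in a..t, psiIntegrand Ψ α g t s

/-- The operator `(1 / Ψ') d/dt`. -/
def psiD (Ψ : ℝ → ℝ) (g : ℝ → ℝ) (t : ℝ) : ℝ :=
  1 / deriv Ψ t * deriv g t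

/-- The `Ψ`-Riemann–Liouville fractional derivative of order `μ`:
`((1 / Ψ') d/dt) ^ m` applied to the `Ψ`-integral of order `m - μ`, with `m = ⌊μ⌋ + 1`. -/
def psiRLDeriv (a : ℝ) (Ψ : ℝ → ℝ) (μ : ℝ) (g : ℝ → ℝ) : ℝ → ℝ :=
  (psiD Ψ)^[⌊μ⌋₊ + 1] (psiIntegral a Ψ ((⌊μ⌋₊ : ℝ) + 1 - μ) g)

/-- The `Ψ`-Riemann–Liouville derivative of order `μ` of `g` exists (in the classical sense) at all
`t > a`: the integral of order `m - μ` converges absolutely, and each of the `m` successive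
differentiations is possible. -/
def PsiRLDifferentiable (a : ℝ) (Ψ : ℝ → ℝ) (μ : ℝ) (g : ℝ → ℝ) : Prop :=
  ∀ t, a < t →
    IntervalIntegrable (psiIntegrand Ψ ((⌊μ⌋₊ : ℝ) + 1 - μ) g t) volume a t ∧
    ∀ k ≤ ⌊μ⌋₊,
      DifferentiableAt ℝ ((psiD Ψ)^[k] (psiIntegral a Ψ ((⌊μ⌋₊ : ℝ) + 1 - μ) g)) t

/-- `u` is a classical solution, for `x ∈ ℝ` and `t > 0`, of the `Ψ`-fractional diffusion equation
of order `μ` with diffusivity `κ`, vanishing as `|x| → ∞`, with initial condition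
`(I ^ (1 - μ) u)(x, 0+) = f x`. -/
structure IsDiffusionSolution (μ κ : ℝ) (Ψ f : ℝ → ℝ) (u : ℝ → ℝ → ℝ) : Prop where
  /-- the fractional derivative in time exists -/
  time_differentiable : ∀ x, PsiRLDifferentiable 0 Ψ μ (fun t => u x t)
  /-- the second derivative in space exists, and is continuous in space -/
  space_contDiff : ∀ t, 0 < t → ContDiff ℝ 2 (fun x => u x t)
  equation : ∀ x t, 0 < t →
    psiRLDeriv 0 Ψ μ (fun s => u x s) t = κ * iteratedDeriv 2 (fun y => u y t) x
  vanishes : ∀ t, 0 < t → Tendsto (fun x => u x t) (cocompact ℝ) (𝓝 0)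
  initial : ∀ x,
    Tendsto (fun t => psiIntegral 0 Ψ (1 - μ) (fun s => u x s) t) (𝓝[>] 0) (𝓝 (f x))

/-- The fundamental solution `G(x, t)`. -/
def diffusionKernel (μ κ : ℝ) (Ψ : ℝ → ℝ) (x t : ℝ) : ℝ :=
  1 / (2 * √κ) * (Ψ t) ^ (μ / 2 - 1) *
    wright (-(|x| / (√κ * (Ψ t) ^ (μ / 2)))) (-(μ / 2)) (μ / 2)

end PsiFractional

end

namespace PsiFractional

/-! Put β = μ/2, c = √κ and k_ν(r, τ) = τ^(ν-1) W(-r/τ^β, -β, ν) (`wrightKernel`). Formally k_ν is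
the inverse Laplace transform in τ of s^(-ν) exp(-r s^β). So -∂/∂r lowers ν by β, ∂/∂τ lowers ν by
1, and Riemann–Liouville integration of order α raises ν by α. The substitution τ = Ψ(t) turns the
Ψ-operators into the ordinary ones, and G = k_β(|x|/c, Ψ(t))/(2c). Both D^μ and κ ∂²/∂x² therefore
carry k_β to k_(-β), which is the equation. The operator I^(1-μ) carries k_β to k_(1-β), which has
mass 2c in x and concentrates at 0 as τ → 0; this is the initial condition.

No Laplace inversion is used. In the coordinate s = e^ζ, W is 1/π times the imaginary part of an
integral along the ray arg s = 2π/3 (`hasSum_wright`). The condition ν < 1 gives convergence at s =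
0, and β ≤ 1/2 keeps cos(β arg s) ≥ 1/2 on every ray used. Moving the ray gives the decay W(-z) =
O(1/(1+z²)) (`exists_abs_wright_le`) and the rule for fractional integrals
(`integral_rpow_mul_wrightKernel`); a Mellin transform gives the mass (`integral_wright_eq_one`).

The quadratic decay fits the hypothesis on f: unit averages of |f| tending to 0 make ∫
|f(η)|/(1+(x-η)²) dη finite and vanishing at infinity, and this integral dominates every
convolution. The kernel is C² across x = η despite the absolute value, because its slope there is a
multiple of 1/Γ(0) = 0. -/

/-! ### Exponential integrals on horizontal lines and shifts of the line -/

/-- The integrand `exp (τ e ^ ζ - r e ^ (β ζ) + a ζ)` on the horizontal line `ζ = u + i θ`. -/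
noncomputable def hankel (β τ r a θ u : ℝ) : ℂ :=
  Complex.exp (τ * Complex.exp (u + θ * Complex.I)
    - r * Complex.exp (β * (u + θ * Complex.I)) + a * (u + θ * Complex.I))

lemma norm_hankel (β τ r a θ u : ℝ) :
    ‖hankel β τ r a θ u‖ =
      Real.exp (τ * Real.exp u * Real.cos θ - r * Real.exp (β * u) * Real.cos (β * θ) + a * u) := by
  simp [hankel, Complex.norm_exp, Complex.exp_re, mul_assoc]

@[fun_prop]
lemma continuous_hankel (β τ r a θ : ℝ) : Continuous (hankel β τ r a θ) := by
  unfold hankel; fun_prop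

lemma image_exp_univ : Real.exp '' univ = Ioi 0 := by
  rw [image_univ, Real.range_exp]

lemma integral_comp_exp {E : Type*} [NormedAddCommGroup E] [NormedSpace ℝ E] (g : ℝ → E) :
    ∫ u, Real.exp u • g (Real.exp u) = ∫ y in Ioi 0, g y := by
  symm
  rw [← image_exp_univ]
  simpa [abs_of_pos (Real.exp_pos _)] using integral_image_eq_integral_abs_deriv_smul
      MeasurableSet.univ (fun x _ ↦ (Real.hasDerivAt_exp x).hasDerivWithinAt)
      (fun x _ y _ hxy ↦ Real.exp_injective hxy) g

lemma integrable_comp_exp {E : Type*} [NormedAddCommGroup E] [NormedSpace ℝ E] (g : ℝ → E) :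
    Integrable (fun u ↦ Real.exp u • g (Real.exp u)) ↔ IntegrableOn g (Ioi 0) := by
  symm
  rw [← image_exp_univ]
  simpa [abs_of_pos (Real.exp_pos _)] using integrableOn_image_iff_integrableOn_abs_deriv_smul
      MeasurableSet.univ (fun x _ ↦ (Real.hasDerivAt_exp x).hasDerivWithinAt)
      (fun x _ y _ hxy ↦ Real.exp_injective hxy) g

lemma integrable_exp_neg_exp {β c b : ℝ} (hβ : 0 < β) (hc : 0 < c) (hb : 0 < b) :
    Integrable (fun u : ℝ => Real.exp (-(c * Real.exp (β * u)) + b * u)) := by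
  have h := (integrable_comp_exp _).2 (integrableOn_rpow_mul_exp_neg_mul_rpow
    (p := β) (s := b - 1) (b := c) (by linarith) hβ hc)
  refine h.congr (Eventually.of_forall fun u => ?_)
  simp only [smul_eq_mul]
  rw [← Real.exp_mul, ← Real.exp_mul, ← Real.exp_add, ← Real.exp_add]
  congr 1
  rw [mul_comm u β]
  ring

lemma exists_mul_exp_le {β c : ℝ} (hβ0 : 0 ≤ β) (hβ : β < 1) (hc : 0 < c) (z : ℝ) :
    ∃ K, ∀ u : ℝ, z * Real.exp (β * u) ≤ K + c * Real.exp u := by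
  -- Beyond u₀ the factor e^((1-β)u) exceeds |z|/c, so c e^u wins; before u₀ the left side is
  -- bounded. The summand 1 keeps the logarithm's argument positive when z = 0.
  set u₀ := Real.log (|z| / c + 1) / (1 - β) with hu₀
  refine ⟨|z| * Real.exp (β * u₀), fun u => ?_⟩
  have h1 : z * Real.exp (β * u) ≤ |z| * Real.exp (β * u) :=
    mul_le_mul_of_nonneg_right (le_abs_self z) (Real.exp_pos _).le
  have hpos : 0 < |z| / c + 1 := by positivity
  rcases le_total u u₀ with h | h
  · have h2 : |z| * Real.exp (β * u) ≤ |z| * Real.exp (β * u₀) := by gcongr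
    have h3 : 0 < c * Real.exp u := by positivity
    linarith
  · have h2 : Real.log (|z| / c + 1) ≤ (1 - β) * u := by
      rw [hu₀, div_le_iff₀ (by linarith)] at h
      linarith
    have h3 : |z| / c + 1 ≤ Real.exp ((1 - β) * u) := by
      rwa [← Real.log_le_iff_le_exp hpos]
    have h4 : |z| ≤ c * Real.exp ((1 - β) * u) := by
      have : |z| / c ≤ Real.exp ((1 - β) * u) := by linarith
      rw [div_le_iff₀ hc] at this
      linarith
    have h5 : |z| * Real.exp (β * u) ≤ c * Real.exp u := by
      calc |z| * Real.exp (β * u) ≤ c * Real.exp ((1 - β) * u) * Real.exp (β * u) := by gcongr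
        _ = c * Real.exp u := by
          rw [mul_assoc, ← Real.exp_add]; congr 2; ring
    have h6 : 0 ≤ |z| * Real.exp (β * u₀) := by positivity
    linarith

lemma integrable_exp_neg_exp_add {β c b : ℝ} (hβ0 : 0 ≤ β) (hβ : β < 1) (hc : 0 < c) (hb : 0 < b)
    (z : ℝ) :
    Integrable (fun u : ℝ => Real.exp (-(c * Real.exp u) + z * Real.exp (β * u) + b * u)) := by
  obtain ⟨K, hK⟩ := exists_mul_exp_le hβ0 hβ (half_pos hc) z
  have h := (integrable_exp_neg_exp one_pos (half_pos hc) hb).const_mul (Real.exp K)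
  refine h.mono' (by fun_prop) (Eventually.of_forall fun u => ?_)
  rw [Real.norm_of_nonneg (Real.exp_pos _).le, ← Real.exp_add]
  refine Real.exp_le_exp.2 ?_
  have := hK u
  rw [one_mul]
  linarith

/-- Horizontal shift of the line of integration of an entire function. -/
lemma integral_horizontal_line_eq {g : ℂ → ℂ} (hg : Differentiable ℂ g) {θ₀ θ₁ : ℝ} {b : ℝ → ℝ}
    (hb : Integrable b) (htop : Tendsto b atTop (𝓝 0)) (hbot : Tendsto b atBot (𝓝 0))
    (hbound : ∀ u : ℝ, ∀ v ∈ uIcc θ₀ θ₁, ‖g (u + v * Complex.I)‖ ≤ b u) :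
    ∫ u : ℝ, g (u + θ₀ * Complex.I) = ∫ u : ℝ, g (u + θ₁ * Complex.I) := by
  have hc : Continuous g := hg.continuous
  have hint : ∀ θ ∈ uIcc θ₀ θ₁, Integrable fun u : ℝ => g (u + θ * Complex.I) := fun θ hθ =>
    hb.mono' (by fun_prop) (Eventually.of_forall fun u => hbound u θ hθ)
  have hside : ∀ l : Filter ℝ, ∀ s : ℝ → ℝ, Tendsto (fun T => b (s T)) l (𝓝 0) →
      Tendsto (fun T => Complex.I • ∫ y in θ₀..θ₁, g (s T + y * Complex.I)) l (𝓝 0) := by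
    intro l s hs
    have h0 : Tendsto (fun T => ∫ y in θ₀..θ₁, g (s T + y * Complex.I)) l (𝓝 0) := by
      refine squeeze_zero_norm (a := fun T => b (s T) * |θ₁ - θ₀|) (fun T => ?_) ?_
      · exact intervalIntegral.norm_integral_le_of_norm_le_const fun y hy =>
          hbound _ _ (uIoc_subset_uIcc hy)
      · simpa using hs.mul_const |θ₁ - θ₀|
    simpa using h0.const_smul Complex.I
  -- Cauchy's theorem on the rectangle [-T, T] × [θ₀, θ₁]; the vertical sides vanish as T → ∞.
  have hrect : ∀ T : ℝ, (∫ x in (-T)..T, g (x + θ₀ * Complex.I))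
      - (∫ x in (-T)..T, g (x + θ₁ * Complex.I))
      + Complex.I • (∫ y in θ₀..θ₁, g ((T : ℝ) + y * Complex.I))
      - Complex.I • (∫ y in θ₀..θ₁, g ((-T : ℝ) + y * Complex.I)) = 0 := by
    intro T
    have := Complex.integral_boundary_rect_eq_zero_of_differentiableOn g
      ((-T : ℝ) + θ₀ * Complex.I) ((T : ℝ) + θ₁ * Complex.I) hg.differentiableOn
    simpa using this
  have h1 := intervalIntegral_tendsto_integral (hint θ₀ left_mem_uIcc)
    tendsto_neg_atTop_atBot tendsto_id
  have h2 := intervalIntegral_tendsto_integral (hint θ₁ right_mem_uIcc)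
    tendsto_neg_atTop_atBot tendsto_id
  have h3 := hside atTop id htop
  have h4 := hside atTop (fun T => -T) (hbot.comp tendsto_neg_atTop_atBot)
  have h5 := ((h1.sub h2).add h3).sub h4
  have h6 := tendsto_nhds_unique (h5.congr fun T => hrect T) tendsto_const_nhds
  simp only [add_zero, sub_zero] at h6
  exact sub_eq_zero.1 h6

lemma tendsto_exp_neg_exp_atTop {β c : ℝ} (hβ : 0 < β) (hc : 0 < c) (b : ℝ) :
    Tendsto (fun u : ℝ => Real.exp (-(c * Real.exp (β * u)) + b * u)) atTop (𝓝 0) := by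
  refine Real.tendsto_exp_atBot.comp ?_
  have h1 : Tendsto (fun u : ℝ => Real.exp (β * u) / (β * u)) atTop atTop := by
    have := (Real.tendsto_exp_div_pow_atTop 1).comp (tendsto_id.const_mul_atTop hβ)
    simpa [Function.comp_def] using this
  have h2 : Tendsto (fun u : ℝ => u * (-(c * β * (Real.exp (β * u) / (β * u))) + b)) atTop atBot :=
    tendsto_id.atTop_mul_atBot₀ (tendsto_atBot_add_const_right _ _
      (tendsto_neg_atTop_atBot.comp (h1.const_mul_atTop (by positivity))))
  refine h2.congr' ?_
  filter_upwards [eventually_gt_atTop 0] with u hu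
  field_simp

lemma tendsto_exp_neg_exp_atBot {c b : ℝ} (hc : 0 < c) (hb : 0 < b) (β : ℝ) :
    Tendsto (fun u : ℝ => Real.exp (-(c * Real.exp (β * u)) + b * u)) atBot (𝓝 0) := by
  refine squeeze_zero (fun u => (Real.exp_pos _).le) (g := fun u => Real.exp (b * u))
    (fun u => Real.exp_le_exp.2 ?_) (Real.tendsto_exp_atBot.comp (tendsto_id.const_mul_atBot hb))
  have : 0 < c * Real.exp (β * u) := by positivity
  linarith

/-! ### The Wright function as a contour integral -/

lemma integral_exp_neg_exp_real {b : ℝ} (hb : 0 < b) :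
    ∫ u : ℝ, Complex.exp (-Complex.exp u + b * u) = Real.Gamma b := by
  rw [Real.Gamma_eq_integral hb, ← integral_comp_exp, ← integral_complex_ofReal]
  refine integral_congr_ae (Eventually.of_forall fun u => ?_)
  simp only [smul_eq_mul]
  rw [← Real.exp_mul, ← Real.exp_add, ← Real.exp_add]
  push_cast
  congr 1
  ring

/-- Euler's integral along a rotated ray, in logarithmic coordinates. -/
lemma integral_exp_neg_exp_complex {b : ℝ} (hb : 0 < b) {w : ℂ} (hw : |w.im| < Real.pi / 2) :
    ∫ u : ℝ, Complex.exp (-Complex.exp (u + w) + b * (u + w)) = Real.Gamma b := by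
  have h1 : ∫ u : ℝ, Complex.exp (-Complex.exp (u + w) + b * (u + w))
      = ∫ u : ℝ, Complex.exp (-Complex.exp (u + w.im * Complex.I) + b * (u + w.im * Complex.I)) := by
    -- The real part of w is a translation of u; only its imaginary part rotates the ray.
    rw [← integral_add_right_eq_self (fun u : ℝ =>
      Complex.exp (-Complex.exp (u + w.im * Complex.I) + b * (u + w.im * Complex.I))) w.re]
    refine integral_congr_ae (Eventually.of_forall fun u => ?_)
    have : ((u + w.re : ℝ) : ℂ) + w.im * Complex.I = u + w := by
      push_cast
      rw [add_assoc, Complex.re_add_im]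
    simp only [this]
  have hcos : 0 < Real.cos w.im := Real.cos_pos_of_mem_Ioo (abs_lt.1 hw)
  rw [h1, ← integral_exp_neg_exp_real hb]
  have h2 := integral_horizontal_line_eq (g := fun ζ => Complex.exp (-Complex.exp ζ + b * ζ))
    (θ₀ := w.im) (θ₁ := 0) (b := fun u => Real.exp (-(Real.cos w.im * Real.exp (1 * u)) + b * u))
    (by fun_prop) (integrable_exp_neg_exp one_pos hcos hb)
    (tendsto_exp_neg_exp_atTop one_pos hcos b) (tendsto_exp_neg_exp_atBot hcos hb 1) ?_
  · simpa using h2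
  · intro u v hv
    have hv' : |v| ≤ |w.im| := by
      simpa using abs_sub_right_of_mem_uIcc hv
    have h3 : Real.cos w.im ≤ Real.cos v := by
      rw [← Real.cos_abs v, ← Real.cos_abs w.im]
      exact Real.cos_le_cos_of_nonneg_of_le_pi (abs_nonneg _) (by linarith [Real.pi_pos]) hv'
    rw [Complex.norm_exp]
    refine Real.exp_le_exp.2 ?_
    have h4 : Real.exp u * Real.cos w.im ≤ Real.exp u * Real.cos v := by gcongr
    simp [Complex.exp_re]
    linarith

lemma cos_two_pi_div_three : Real.cos (2 * Real.pi / 3) = -(1 / 2) := by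
  rw [show 2 * Real.pi / 3 = Real.pi - Real.pi / 3 by ring, Real.cos_pi_sub, Real.cos_pi_div_three]

lemma half_le_cos_mul {β θ : ℝ} (hβ0 : 0 ≤ β) (hβ : β ≤ 1 / 2) (hθ0 : 0 ≤ θ)
    (hθ : θ ≤ 2 * Real.pi / 3) : 1 / 2 ≤ Real.cos (β * θ) := by
  rw [← Real.cos_pi_div_three]
  have := Real.pi_pos
  refine Real.cos_le_cos_of_nonneg_of_le_pi (by positivity) (by linarith) ?_
  nlinarith

/-- Euler's reflection formula. If b is an integer, then 1 - b is a pole and both sides are 0 by the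
convention for 1/Γ. -/
lemma im_gamma_mul_exp_div_pi {b : ℝ} (hb : 0 < b) :
    ((Real.Gamma b : ℂ) * Complex.exp (Real.pi * b * Complex.I)).im / Real.pi
      = 1 / Real.Gamma (1 - b) := by
  have h1 : ((Real.Gamma b : ℂ) * Complex.exp (Real.pi * b * Complex.I)).im
      = Real.Gamma b * Real.sin (Real.pi * b) := by
    rw [Complex.im_ofReal_mul, ← Complex.ofReal_mul, Complex.exp_ofReal_mul_I_im]
  rw [h1]
  have h := Real.Gamma_mul_Gamma_one_sub b
  by_cases hs : Real.sin (Real.pi * b) = 0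
  · have hG : Real.Gamma (1 - b) = 0 := by
      rw [hs, div_zero] at h
      exact (mul_eq_zero.1 h).resolve_left (Real.Gamma_pos_of_pos hb).ne'
    simp [hs, hG]
  · have hG : Real.Gamma (1 - b) ≠ 0 := by
      intro h0
      rw [h0, mul_zero] at h
      exact div_ne_zero Real.pi_ne_zero hs h.symm
    have hpi := Real.pi_ne_zero
    rw [eq_div_iff hs] at h
    rw [div_eq_div_iff hpi hG]
    linarith

/-- Since 2π/3 = π - π/3, writing ζ = w + iπ gives e^ζ = -e^w with Im w = -π/3. This is Euler's
integral on a rotated ray, times e^(iπb). -/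
lemma integral_hankel_monomial {b : ℝ} (hb : 0 < b) :
    ∫ u : ℝ, Complex.exp (Complex.exp (u + (2 * Real.pi / 3 : ℝ) * Complex.I)
      + b * (u + (2 * Real.pi / 3 : ℝ) * Complex.I))
      = Real.Gamma b * Complex.exp (Real.pi * b * Complex.I) := by
  have hpi := Real.pi_pos
  rw [← integral_exp_neg_exp_complex hb (w := ((-(Real.pi / 3) : ℝ) : ℂ) * Complex.I)
    (by
      rw [Complex.im_ofReal_mul, Complex.I_im, mul_one, abs_neg, abs_of_pos (by positivity)]
      linarith), ← integral_mul_const]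
  refine integral_congr_ae (Eventually.of_forall fun u => ?_)
  simp only
  rw [← Complex.exp_add]
  have h : (u : ℂ) + (2 * Real.pi / 3 : ℝ) * Complex.I
      = u + ((-(Real.pi / 3) : ℝ) : ℂ) * Complex.I + Real.pi * Complex.I := by
    push_cast; ring
  rw [h, Complex.exp_add_pi_mul_I]
  congr 1
  ring

/-- The Wright function as an integral over two rays. -/
lemma hasSum_wright {β ν : ℝ} (hβ0 : 0 ≤ β) (hβ : β < 1) (hν : ν < 1) (z : ℝ) :
    HasSum (fun j : ℕ => (-z) ^ j / ((j.factorial : ℝ) * Real.Gamma (-β * j + ν)))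
      ((∫ u, hankel β 1 z (1 - ν) (2 * Real.pi / 3) u).im / Real.pi) := by
  set θ : ℝ := 2 * Real.pi / 3 with hθ
  set F : ℕ → ℝ → ℂ := fun j u => ((-z) ^ j / (j.factorial : ℝ) : ℝ) *
    Complex.exp (Complex.exp (u + θ * Complex.I)
      + ((1 - ν + β * j : ℝ) : ℂ) * (u + θ * Complex.I)) with hF
  set bd : ℕ → ℝ → ℝ := fun j u => (|z| * Real.exp (β * u)) ^ j / (j.factorial : ℝ) *
    Real.exp (-(1 / 2 * Real.exp u) + (1 - ν) * u) with hbd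
  have hbsum : ∀ u, HasSum (fun j => bd j u)
      (Real.exp (-(1 / 2 * Real.exp u) + |z| * Real.exp (β * u) + (1 - ν) * u)) := by
    intro u
    have := (NormedSpace.expSeries_div_hasSum_exp (|z| * Real.exp (β * u))).mul_right
      (Real.exp (-(1 / 2 * Real.exp u) + (1 - ν) * u))
    rw [← Real.exp_eq_exp_ℝ, ← Real.exp_add] at this
    have e : |z| * Real.exp (β * u) + (-(1 / 2 * Real.exp u) + (1 - ν) * u)
      = -(1 / 2 * Real.exp u) + |z| * Real.exp (β * u) + (1 - ν) * u := by ring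
    rwa [e] at this
  -- Expand exp(-z e^(βζ)) and integrate termwise. The sum of the absolute values grows only like
  -- exp(|z| e^(βu)), which exp(-e^u/2) absorbs because β < 1.
  have key : HasSum (fun j => ∫ u, F j u) (∫ u, hankel β 1 z (1 - ν) θ u) := by
    refine hasSum_integral_of_dominated_convergence bd (fun j => ?_) (fun j => ?_) ?_ ?_ ?_
    · exact Continuous.aestronglyMeasurable (by simp only [hF]; fun_prop)
    · refine Eventually.of_forall fun u => ?_
      simp only [hF, hbd]
      rw [norm_mul, Complex.norm_real, Complex.norm_exp, mul_pow, ← Real.exp_nat_mul, norm_div,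
        norm_pow, Real.norm_eq_abs, abs_neg, Real.norm_natCast, mul_div_right_comm, mul_assoc,
        ← Real.exp_add]
      refine le_of_eq ?_
      congr 2
      simp [Complex.exp_re, hθ]
      rw [cos_two_pi_div_three]
      ring
    · exact Eventually.of_forall fun u => (hbsum u).summable
    · simp_rw [fun u => (hbsum u).tsum_eq]
      exact integrable_exp_neg_exp_add hβ0 hβ (by norm_num) (by linarith) _
    · refine Eventually.of_forall fun u => ?_
      have := (NormedSpace.expSeries_div_hasSum_exp
        (-(z : ℂ) * Complex.exp (β * (u + θ * Complex.I)))).mul_right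
        (Complex.exp (Complex.exp (u + θ * Complex.I) + ((1 - ν : ℝ) : ℂ) * (u + θ * Complex.I)))
      rw [← Complex.exp_eq_exp_ℂ, ← Complex.exp_add] at this
      have e : hankel β 1 z (1 - ν) θ u = Complex.exp
          (-(z : ℂ) * Complex.exp (β * (u + θ * Complex.I)) +
          (Complex.exp (u + θ * Complex.I) + ((1 - ν : ℝ) : ℂ) * (u + θ * Complex.I))) := by
        simp only [hankel]
        push_cast
        congr 1
        ring
      rw [e]
      refine this.congr_fun fun j => ?_
      · simp only [hF]
        rw [mul_pow, ← Complex.exp_nat_mul, mul_div_right_comm, mul_assoc, ← Complex.exp_add]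
        push_cast
        congr 2
        ring
  have him := (Complex.hasSum_im key).div_const Real.pi
  refine him.congr_fun fun j => ?_
  have hb : 0 < 1 - ν + β * j := by
    have : 0 ≤ β * j := by positivity
    linarith
  simp only [hF]
  rw [integral_const_mul, integral_hankel_monomial hb, Complex.im_ofReal_mul, mul_div_assoc,
    im_gamma_mul_exp_div_pi hb]
  rw [div_mul_div_comm, mul_one]
  congr 3
  ring

lemma wright_neg_eq {β ν : ℝ} (hβ0 : 0 ≤ β) (hβ : β < 1) (hν : ν < 1) (z : ℝ) :
    wright (-z) (-β) ν = (∫ u, hankel β 1 z (1 - ν) (2 * Real.pi / 3) u).im / Real.pi :=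
  (hasSum_wright hβ0 hβ hν z).tsum_eq

lemma hasSum_wright' {β ν : ℝ} (hβ0 : 0 ≤ β) (hβ : β < 1) (hν : ν < 1) (z : ℝ) :
    HasSum (fun j : ℕ => (-z) ^ j / ((j.factorial : ℝ) * Real.Gamma (-β * j + ν)))
      (wright (-z) (-β) ν) := by
  rw [wright_neg_eq hβ0 hβ hν]
  exact hasSum_wright hβ0 hβ hν z

lemma norm_hankel_le {β : ℝ} (hβ0 : 0 ≤ β) (hβ : β ≤ 1 / 2) {z : ℝ} (hz : 0 ≤ z) (a u : ℝ) :
    ‖hankel β 1 z a (2 * Real.pi / 3) u‖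
      ≤ Real.exp (-(1 / 2 * Real.exp u) + -(z / 2) * Real.exp (β * u) + a * u) := by
  rw [norm_hankel, cos_two_pi_div_three]
  refine Real.exp_le_exp.2 ?_
  have h := half_le_cos_mul hβ0 hβ (θ := 2 * Real.pi / 3) (by positivity) le_rfl
  have h2 : z * Real.exp (β * u) * (1 / 2) ≤
    z * Real.exp (β * u) * Real.cos (β * (2 * Real.pi / 3)) := by gcongr
  linarith

lemma norm_hankel_le_abs {β z Z : ℝ} (hz : |z| ≤ Z) (a u : ℝ) :
    ‖hankel β 1 z a (2 * Real.pi / 3) u‖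
      ≤ Real.exp (-(1 / 2 * Real.exp u) + Z * Real.exp (β * u) + a * u) := by
  rw [norm_hankel, cos_two_pi_div_three]
  refine Real.exp_le_exp.2 ?_
  have h2 : -(z * Real.exp (β * u) * Real.cos (β * (2 * Real.pi / 3))) ≤ Z * Real.exp (β * u) := by
    refine (neg_le_abs _).trans ?_
    rw [abs_mul, abs_mul, Real.abs_exp]
    calc |z| * Real.exp (β * u) * |Real.cos (β * (2 * Real.pi / 3))|
        ≤ Z * Real.exp (β * u) * 1 := by
          gcongr
          · exact mul_nonneg ((abs_nonneg z).trans hz) (Real.exp_pos _).le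
          · exact Real.abs_cos_le_one _
      _ = _ := mul_one _
  linarith

lemma integrable_hankel {β a : ℝ} (hβ0 : 0 ≤ β) (hβ : β < 1) (ha : 0 < a) (z : ℝ) :
    Integrable (hankel β 1 z a (2 * Real.pi / 3)) :=
  (integrable_exp_neg_exp_add hβ0 hβ (by norm_num) ha |z|).mono' (by fun_prop)
    (Eventually.of_forall fun u => norm_hankel_le_abs le_rfl a u)

/-! ### Derivative and contiguous relation -/

/-- Differentiation in z brings down -e^(βζ), which replaces 1 - ν by 1 - (ν - β) in the exponent.
-/
lemma hasDerivAt_wright {β ν : ℝ} (hβ0 : 0 ≤ β) (hβ : β < 1) (hν : ν < 1) (z : ℝ) :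
    HasDerivAt (fun z => wright (-z) (-β) ν) (-wright (-z) (-β) (ν - β)) z := by
  have hd := (hasDerivAt_integral_of_dominated_loc_of_deriv_le (μ := volume)
    (F := fun z u => hankel β 1 z (1 - ν) (2 * Real.pi / 3) u)
    (F' := fun z u => -hankel β 1 z (1 - (ν - β)) (2 * Real.pi / 3) u)
    (bound := fun u => Real.exp (-(1 / 2 * Real.exp u) + (|z| + 1) * Real.exp (β * u)
      + (1 - (ν - β)) * u))
    (Metric.ball_mem_nhds z one_pos) (Eventually.of_forall fun _ => by fun_prop)
    (integrable_hankel hβ0 hβ (by linarith) z) (by fun_prop)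
    (Eventually.of_forall fun u y hy => ?_)
    (integrable_exp_neg_exp_add hβ0 hβ (by norm_num) (by linarith) _)
    (Eventually.of_forall fun u y hy => ?_)).2
  · have h2 := (Complex.imCLM.hasFDerivAt.comp_hasDerivAt z hd).div_const Real.pi
    refine (h2.congr_deriv ?_).congr_of_eventuallyEq (Eventually.of_forall fun y => ?_)
    · rw [wright_neg_eq hβ0 hβ (by linarith), integral_neg]
      simp [neg_div]
    · simp [wright_neg_eq hβ0 hβ hν]
  · rw [norm_neg]
    refine norm_hankel_le_abs ?_ _ _
    rw [Metric.mem_ball, Real.dist_eq] at hy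
    have := abs_sub_abs_le_abs_sub y z
    linarith
  · have h1 : HasDerivAt (fun y : ℝ => (1 : ℝ) * Complex.exp (u + (2 * Real.pi / 3 : ℝ) * Complex.I)
        - y * Complex.exp (β * (u + (2 * Real.pi / 3 : ℝ) * Complex.I))
        + (1 - ν : ℝ) * (u + (2 * Real.pi / 3 : ℝ) * Complex.I))
        (-(1 * Complex.exp (β * (u + (2 * Real.pi / 3 : ℝ) * Complex.I)))) y :=
      (((Complex.ofRealCLM.hasDerivAt.mul_const _).const_sub _).add_const _)
    refine h1.cexp.congr_deriv ?_
    simp only [hankel]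
    rw [one_mul, mul_neg, ← Complex.exp_add]
    push_cast
    congr 2
    ring

@[fun_prop]
lemma continuous_wright {β ν : ℝ} (hβ0 : 0 ≤ β) (hβ : β < 1) (hν : ν < 1) :
    Continuous (fun z => wright (-z) (-β) ν) :=
  continuous_iff_continuousAt.2 fun z => (hasDerivAt_wright hβ0 hβ hν z).continuousAt

/-- Valid without exception: at x = 1 and at the poles both sides are 0 by the convention Γ(-n) = 0.
-/
lemma Gamma_recurrence (x : ℝ) : (x - 1) / Real.Gamma x = 1 / Real.Gamma (x - 1) := by
  by_cases hx : x - 1 = 0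
  · simp [hx]
  · have h := Real.Gamma_add_one hx
    rw [sub_add_cancel] at h
    rw [h]
    by_cases hG : Real.Gamma (x - 1) = 0
    · simp [hG]
    · field_simp

/-- The contiguous relation of the Wright function. -/
lemma wright_contiguous {β ν : ℝ} (hβ0 : 0 ≤ β) (hβ : β < 1) (hν : ν < 1) (z : ℝ) :
    (ν - 1) * wright (-z) (-β) ν + β * z * wright (-z) (-β) (ν - β)
      = wright (-z) (-β) (ν - 1) := by
  have h1 := (hasSum_wright' hβ0 hβ hν z).mul_left (ν - 1)
  have h2 := (hasSum_wright' hβ0 hβ (show ν - β < 1 by linarith) z).mul_left (β * z)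
  have h3 : HasSum (fun j : ℕ => -(β * j) * ((-z) ^ j / ((j.factorial : ℝ) *
      Real.Gamma (-β * j + ν)))) (β * z * wright (-z) (-β) (ν - β)) := by
    -- The term j = 0 vanishes, and in the term j + 1 the factor j + 1 cancels against the
    -- factorial.
    rw [← hasSum_nat_add_iff' 1]
    simp only [Finset.range_one, Finset.sum_singleton, Nat.cast_zero, mul_zero, neg_zero, zero_mul,
      sub_zero]
    refine h2.congr_fun ?_
    intro j
    have : -β * ((j + 1 : ℕ) : ℝ) + ν = -β * j + (ν - β) := by push_cast; ring
    rw [this, Nat.factorial_succ]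
    push_cast
    have hj : (j : ℝ) + 1 ≠ 0 := by positivity
    have hf : (j.factorial : ℝ) ≠ 0 := by positivity
    rw [pow_succ]
    generalize Real.Gamma (-β * j + (ν - β)) = G
    by_cases hG : G = 0
    · simp [hG]
    · field_simp
  refine (h1.add h3).unique ?_
  refine (hasSum_wright' hβ0 hβ (show ν - 1 < 1 by linarith) z).congr_fun fun j => ?_
  have h4 := Gamma_recurrence (-β * j + ν)
  rw [show -β * (j : ℝ) + (ν - 1) = -β * j + ν - 1 by ring]
  calc _ = ((-z) ^ j / (j.factorial : ℝ)) * ((-β * j + ν - 1) / Real.Gamma (-β * j + ν)) := by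
        rw [← div_div]; ring
    _ = _ := by rw [h4, div_mul_div_comm, mul_one]

/-! ### Moving the ray; decay on the negative half-line -/

/-- Here exp(τs) has modulus at most 1 and all damping comes from exp(-r s^β), so the bound does not
depend on τ. -/
lemma norm_hankel_le_of_mul_cos_nonpos {β : ℝ} (hβ0 : 0 ≤ β) (hβ : β ≤ 1 / 2) {τ r θ : ℝ}
    (hr : 0 ≤ r) (hθ0 : 0 ≤ θ) (hθ : θ ≤ 2 * Real.pi / 3) (hτ : τ * Real.cos θ ≤ 0) (a u : ℝ) :
    ‖hankel β τ r a θ u‖ ≤ Real.exp (-(r / 2 * Real.exp (β * u)) + a * u) := by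
  rw [norm_hankel]
  refine Real.exp_le_exp.2 ?_
  have h2 : r * Real.exp (β * u) * (1 / 2) ≤ r * Real.exp (β * u) * Real.cos (β * θ) := by
    have := half_le_cos_mul hβ0 hβ hθ0 hθ
    gcongr
  have h3 : τ * Real.exp u * Real.cos θ ≤ 0 := by
    rw [mul_right_comm]
    exact mul_nonpos_of_nonpos_of_nonneg hτ (Real.exp_pos u).le
  linarith

lemma integrable_hankel_of_mul_cos_nonpos {β : ℝ} (hβ0 : 0 < β) (hβ : β ≤ 1 / 2) {τ r θ a : ℝ}
    (hr : 0 < r) (ha : 0 < a) (hθ0 : 0 ≤ θ) (hθ : θ ≤ 2 * Real.pi / 3)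
    (hτ : τ * Real.cos θ ≤ 0) : Integrable (hankel β τ r a θ) :=
  (integrable_exp_neg_exp hβ0 (half_pos hr) ha).mono' (by fun_prop) (Eventually.of_forall fun u =>
    norm_hankel_le_of_mul_cos_nonpos hβ0.le hβ hr.le hθ0 hθ hτ a u)

lemma integral_hankel_shift {β : ℝ} (hβ0 : 0 < β) (hβ : β ≤ 1 / 2) {τ r a θ₀ θ₁ : ℝ}
    (hr : 0 < r) (ha : 0 < a) (hθ0 : 0 ≤ θ₀) (hθ01 : θ₀ ≤ θ₁) (hθ1 : θ₁ ≤ 2 * Real.pi / 3)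
    (hτ : ∀ v ∈ Icc θ₀ θ₁, τ * Real.cos v ≤ 0) :
    ∫ u, hankel β τ r a θ₀ u = ∫ u, hankel β τ r a θ₁ u := by
  refine integral_horizontal_line_eq (g := fun ζ => Complex.exp (τ * Complex.exp ζ
    - r * Complex.exp (β * ζ) + a * ζ)) (by fun_prop)
    (integrable_exp_neg_exp hβ0 (half_pos hr) ha) (tendsto_exp_neg_exp_atTop hβ0 (half_pos hr) a)
    (tendsto_exp_neg_exp_atBot (half_pos hr) ha β) fun u v hv => ?_
  rw [uIcc_of_le hθ01] at hv
  exact norm_hankel_le_of_mul_cos_nonpos hβ0.le hβ hr.le (hθ0.trans hv.1) (hv.2.trans hθ1)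
    (hτ v hv) a u

lemma im_integral_hankel_zero_angle (β τ r a : ℝ) : (∫ u, hankel β τ r a 0 u).im = 0 := by
  have h : ∀ u, hankel β τ r a 0 u
      = ((Real.exp (τ * Real.exp u - r * Real.exp (β * u) + a * u) : ℝ) : ℂ) := by
    intro u
    simp [hankel]
  simp_rw [h]
  rw [integral_complex_ofReal, Complex.ofReal_im]

lemma norm_cexp_sub_one_le_of_re_nonpos {s : ℂ} (hs : s.re ≤ 0) : ‖Complex.exp s - 1‖ ≤ ‖s‖ := by
  have h := (convex_halfSpace_re_le 0).norm_image_sub_le_of_norm_hasDerivWithin_le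
    (f := Complex.exp) (f' := Complex.exp) (C := 1) (x := 0) (y := s)
    (fun x _ => (Complex.hasDerivAt_exp x).hasDerivWithinAt) (fun x hx => ?_) (by simp) hs
  · simpa using h
  · rw [Complex.norm_exp]
    exact Real.exp_le_one_iff.2 hx

lemma sq_mul_exp_neg_le {x : ℝ} (hx : 0 ≤ x) : x ^ 2 * Real.exp (-(x / 2)) ≤
    64 * Real.exp (-(x / 4)) := by
  have h1 : x / 8 ≤ Real.exp (x / 8) := by linarith [Real.add_one_le_exp (x / 8)]
  have h2 : x ^ 2 ≤ 64 * Real.exp (x / 4) := by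
    have : (x / 8) ^ 2 ≤ Real.exp (x / 8) ^ 2 := by gcongr
    rw [← Real.exp_nat_mul] at this
    push_cast at this
    rw [show (2 : ℝ) * (x / 8) = x / 4 by ring] at this
    linarith
  calc x ^ 2 * Real.exp (-(x / 2)) ≤ 64 * Real.exp (x / 4) * Real.exp (-(x / 2)) := by gcongr
    _ = _ := by
      rw [mul_assoc, ← Real.exp_add]
      congr 2
      ring

/-- Decay of the Wright function on the negative half-line. -/
lemma exists_abs_wright_le {β ν : ℝ} (hβ0 : 0 < β) (hβ : β ≤ 1 / 2) (hν : ν < 1) :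
    ∃ C, 0 ≤ C ∧ ∀ z, 0 ≤ z → |wright (-z) (-β) ν| ≤ C / (1 + z ^ 2) := by
  have hpi := Real.pi_pos
  have ha : 0 < 1 - ν := by linarith
  -- The exponent left after gaining e^u from |e^s - 1| ≤ |s| and paying e^(-2βu) to trade z² for (z
  -- e^(βu))².
  have ha2 : 0 < 1 - ν + 1 - 2 * β := by linarith
  set A := ∫ u : ℝ, Real.exp (-(1 / 2 * Real.exp (1 * u)) + (1 - ν) * u) with hA
  set B := ∫ u : ℝ, 64 * Real.exp (-(1 / 4 * Real.exp (β * u)) + (1 - ν + 1 - 2 * β) * u) with hB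
  have hA0 : 0 ≤ A := integral_nonneg fun u => (Real.exp_pos _).le
  have hB0 : 0 ≤ B := integral_nonneg fun u => by positivity
  have h1 : ∀ z, 0 ≤ z → |wright (-z) (-β) ν| ≤ A / Real.pi := by
    intro z hz
    rw [wright_neg_eq hβ0.le (by linarith) hν, abs_div, abs_of_pos hpi]
    gcongr
    refine (Complex.abs_im_le_norm _).trans ?_
    refine norm_integral_le_of_norm_le (integrable_exp_neg_exp one_pos (by norm_num) ha)
      (Eventually.of_forall fun u => (norm_hankel_le hβ0.le hβ hz _ u).trans
        (Real.exp_le_exp.2 ?_))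
    have : 0 ≤ z / 2 * Real.exp (β * u) := by positivity
    rw [one_mul]
    linarith
  have h2 : ∀ z, 1 ≤ z → z ^ 2 * |wright (-z) (-β) ν| ≤ B / Real.pi := by
    intro z hz
    have hz0 : 0 < z := by linarith
    set θ := 2 * Real.pi / 3 with hθ
    -- Without the factor e^s the ray can be turned to the positive axis, where the integrand is
    -- real. Subtracting this integral changes nothing in the imaginary part and replaces e^s by e^s
    -- - 1.
    have hzero : (∫ u, hankel β 0 z (1 - ν) θ u).im = 0 := by
      rw [← integral_hankel_shift hβ0 hβ hz0 ha le_rfl (by positivity) le_rfl (by simp)]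
      exact im_integral_hankel_zero_angle _ _ _ _
    have hsub : (∫ u, hankel β 1 z (1 - ν) θ u).im
        = (∫ u, (hankel β 1 z (1 - ν) θ u - hankel β 0 z (1 - ν) θ u)).im := by
      rw [integral_sub (integrable_hankel hβ0.le (by linarith) ha z)
        (integrable_hankel_of_mul_cos_nonpos hβ0 hβ hz0 ha (by positivity) le_rfl (by simp)),
        Complex.sub_im, hzero, sub_zero]
    rw [wright_neg_eq hβ0.le (by linarith) hν, abs_div, abs_of_pos hpi, ← mul_div_assoc]
    gcongr
    rw [hsub]
    calc z ^ 2 * |(∫ u, (hankel β 1 z (1 - ν) θ u - hankel β 0 z (1 - ν) θ u)).im|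
        ≤ ‖∫ u, ((z ^ 2 : ℝ) : ℂ) * (hankel β 1 z (1 - ν) θ u - hankel β 0 z (1 - ν) θ u)‖ := by
          rw [integral_const_mul, norm_mul, Complex.norm_real, Real.norm_of_nonneg (sq_nonneg z)]
          gcongr
          exact Complex.abs_im_le_norm _
      _ ≤ B := by
          refine norm_integral_le_of_norm_le
            ((integrable_exp_neg_exp hβ0 (by norm_num) ha2).const_mul 64)
            (Eventually.of_forall fun u => ?_)
          have e : hankel β 1 z (1 - ν) θ u - hankel β 0 z (1 - ν) θ u
              = (Complex.exp (Complex.exp (u + θ * Complex.I)) - 1) * hankel β 0 z (1 - ν) θ u := by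
            rw [sub_mul, one_mul]
            simp only [hankel]
            rw [← Complex.exp_add]
            congr 2
            push_cast
            ring
          have hre : (Complex.exp (u + θ * Complex.I)).re ≤ 0 := by
            simp only [Complex.exp_re]
            simp [hθ, cos_two_pi_div_three]
            positivity
          have hn : ‖Complex.exp (u + θ * Complex.I)‖ = Real.exp u := by
            simp [Complex.norm_exp]
          rw [e, norm_mul, norm_mul, Complex.norm_real, Real.norm_of_nonneg (sq_nonneg z)]
          have h3 := norm_cexp_sub_one_le_of_re_nonpos hre
          rw [hn] at h3
          have h4 := norm_hankel_le_of_mul_cos_nonpos hβ0.le hβ (τ := 0) hz0.le (θ := θ)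
            (by positivity) le_rfl (by simp) (1 - ν) u
          have h5 := sq_mul_exp_neg_le (x := z * Real.exp (β * u)) (by positivity)
          have h6 : Real.exp (-(z * Real.exp (β * u) / 4)) ≤
              Real.exp (-(1 / 4 * Real.exp (β * u))) := by
            refine Real.exp_le_exp.2 ?_
            have : 1 * Real.exp (β * u) ≤ z * Real.exp (β * u) := by gcongr
            linarith
          calc z ^ 2 * (‖Complex.exp (Complex.exp (u + θ * Complex.I)) - 1‖ *
                ‖hankel β 0 z (1 - ν) θ u‖)
              ≤ z ^ 2 * (Real.exp u * Real.exp (-(z / 2 * Real.exp (β * u)) + (1 - ν) * u)) := by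
                gcongr
            _ = ((z * Real.exp (β * u)) ^ 2 * Real.exp (-(z * Real.exp (β * u) / 2))) *
                Real.exp ((1 - ν + 1 - 2 * β) * u) := by
                rw [mul_pow, ← Real.exp_nat_mul, ← Real.exp_add, mul_assoc, mul_assoc,
                  ← Real.exp_add, ← Real.exp_add]
                congr 2
                push_cast
                ring
            _ ≤ (64 * Real.exp (-(1 / 4 * Real.exp (β * u)))) *
                Real.exp ((1 - ν + 1 - 2 * β) * u) := by
                exact mul_le_mul_of_nonneg_right
                  (h5.trans (mul_le_mul_of_nonneg_left h6 (by norm_num))) (Real.exp_pos _).le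
            _ = _ := by rw [mul_assoc, ← Real.exp_add]
  refine ⟨(2 * A + B) / Real.pi, by positivity, fun z hz => ?_⟩
  rw [le_div_iff₀ (by positivity)]
  have e1 := h1 z hz
  have hAB : (2 * A + B) / Real.pi = A / Real.pi + A / Real.pi + B / Real.pi := by ring
  have hA' : 0 ≤ A / Real.pi := by positivity
  have hB' : 0 ≤ B / Real.pi := by positivity
  rcases le_total z 1 with h | h
  · have : z ^ 2 ≤ 1 := by nlinarith
    have : |wright (-z) (-β) ν| * z ^ 2 ≤ |wright (-z) (-β) ν| * 1 := by gcongr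
    linarith
  · have := h2 z h
    linarith

/-! ### The self-similar kernel -/

/-- The function `r, τ ↦ τ ^ (ν - 1) W (-r / τ ^ β, -β, ν)`, whose Laplace transform in `τ` is
`s ^ (-ν) exp (-r s ^ β)`. -/
noncomputable def wrightKernel (β ν r τ : ℝ) : ℝ :=
  τ ^ (ν - 1) * wright (-(r / τ ^ β)) (-β) ν

/-- The scaling s ↦ s/τ, which is the translation of u by log τ. -/
lemma wrightKernel_eq {β ν : ℝ} (hβ0 : 0 ≤ β) (hβ : β < 1) (hν : ν < 1) (r : ℝ) {τ : ℝ}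
    (hτ : 0 < τ) :
    wrightKernel β ν r τ = (∫ u, hankel β τ r (1 - ν) (2 * Real.pi / 3) u).im / Real.pi := by
  rw [wrightKernel, wright_neg_eq hβ0 hβ hν,
    ← integral_sub_right_eq_self (hankel β τ r (1 - ν) (2 * Real.pi / 3)) (Real.log τ),
    ← mul_div_assoc, ← Complex.im_ofReal_mul, ← integral_const_mul]
  congr 3
  funext u
  have e1 : τ ^ (ν - 1) = Real.exp (Real.log τ * (ν - 1)) := Real.rpow_def_of_pos hτ _
  have e2 : r / τ ^ β = r * Real.exp (-(Real.log τ * β)) := by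
    rw [Real.rpow_def_of_pos hτ, Real.exp_neg, div_eq_mul_inv]
  have e3 : (τ : ℂ) = Complex.exp (Real.log τ) := by
    rw [← Complex.ofReal_exp, Real.exp_log hτ]
  rw [e1, e2]
  simp only [hankel]
  rw [e3]
  generalize Real.log τ = l
  push_cast
  rw [mul_assoc (r : ℂ), ← Complex.exp_add, ← Complex.exp_add, ← Complex.exp_add]
  congr 1
  have h1 : (l : ℂ) + (u - l + 2 * Real.pi / 3 * Complex.I) = u + 2 * Real.pi / 3 * Complex.I := by
    ring
  have h2 : -((l : ℂ) * β) + β * (u + 2 * Real.pi / 3 * Complex.I)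
      = β * (u - l + 2 * Real.pi / 3 * Complex.I) := by
    ring
  rw [h1, h2]
  ring

/-! ### Fractional integration of the kernel, along the imaginary axis -/

section FractionalIntegral

variable {β a r : ℝ}

lemma norm_integral_hankel_imaginary_le (hβ0 : 0 < β) (hβ : β ≤ 1 / 2) (hr : 0 < r) (ha : 0 < a)
    (τ : ℝ) : ‖∫ u, hankel β τ r a (Real.pi / 2) u‖
      ≤ ∫ u : ℝ, Real.exp (-(r / 2 * Real.exp (β * u)) + a * u) := by
  have hpi := Real.pi_pos
  exact norm_integral_le_of_norm_le (integrable_exp_neg_exp hβ0 (half_pos hr) ha)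
    (Eventually.of_forall fun u => norm_hankel_le_of_mul_cos_nonpos hβ0.le hβ hr.le (by positivity)
      (by linarith) (by simp) a u)

lemma continuous_integral_hankel_imaginary (hβ0 : 0 < β) (hβ : β ≤ 1 / 2) (hr : 0 < r)
    (ha : 0 < a) : Continuous fun τ => ∫ u, hankel β τ r a (Real.pi / 2) u := by
  have hpi := Real.pi_pos
  refine continuous_of_dominated (fun τ => by fun_prop) (fun τ => Eventually.of_forall fun u =>
      norm_hankel_le_of_mul_cos_nonpos hβ0.le hβ hr.le (by positivity)
      (by linarith) (by simp) a u)
    (integrable_exp_neg_exp hβ0 (half_pos hr) ha) (Eventually.of_forall fun u => ?_)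
  unfold hankel
  fun_prop

/-- Causality: for τ ≤ 0 the factor exp(τs) is bounded on 0 ≤ arg s ≤ π/2, so the ray turns to the
positive axis. -/
lemma im_integral_hankel_imaginary_of_nonpos (hβ0 : 0 < β) (hβ : β ≤ 1 / 2) (hr : 0 < r)
    (ha : 0 < a) {τ : ℝ} (hτ : τ ≤ 0) : (∫ u, hankel β τ r a (Real.pi / 2) u).im = 0 := by
  have hpi := Real.pi_pos
  rw [← integral_hankel_shift hβ0 hβ hr ha le_rfl (by positivity) (by linarith)
    fun v hv => mul_nonpos_of_nonpos_of_nonneg hτ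
      (Real.cos_nonneg_of_mem_Icc ⟨by linarith [hv.1], hv.2⟩)]
  exact im_integral_hankel_zero_angle _ _ _ _

/-- For τ > 0 the ray turns the other way, to arg s = 2π/3. The imaginary axis is thus the one ray
that serves every real τ. -/
lemma im_integral_hankel_imaginary_of_pos {ν : ℝ} (hβ0 : 0 < β) (hβ : β ≤ 1 / 2) (hr : 0 < r)
    (hν : ν < 1) {τ : ℝ} (hτ : 0 < τ) :
    (∫ u, hankel β τ r (1 - ν) (Real.pi / 2) u).im = Real.pi * wrightKernel β ν r τ := by
  have hpi := Real.pi_pos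
  rw [integral_hankel_shift (θ₁ := 2 * Real.pi / 3) hβ0 hβ hr (by linarith) (by positivity)
    (by linarith) le_rfl
    fun v hv => mul_nonpos_of_nonneg_of_nonpos hτ.le
      (Real.cos_nonpos_of_pi_div_two_le_of_le hv.1 (by linarith [hv.2])),
    wrightKernel_eq hβ0.le (by linarith) hν r hτ]
  field_simp

/-- Fubini and ∫ ρ^(α-1) e^(-ερ - ρs) dρ = Γ(α)(ε + s)^(-α) with ρ = e^v and s = i e^u. The damping
ε makes Re(ε + s) > 0. -/
lemma integral_damped_hankel {α ε : ℝ} (hβ0 : 0 < β) (hβ : β ≤ 1 / 2) (hr : 0 < r) (ha : 0 < a)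
    (hα : 0 < α) (hε : 0 < ε) (τ : ℝ) :
    ∫ v : ℝ, (Real.exp (-(ε * Real.exp (1 * v)) + α * v) : ℂ) *
        ∫ u, hankel β (τ - Real.exp v) r a (Real.pi / 2) u
      = Real.Gamma α * ∫ u : ℝ, Complex.exp (-(α * Complex.log (ε + Real.exp u * Complex.I))) *
        hankel β τ r a (Real.pi / 2) u := by
  have hpi := Real.pi_pos
  have hint : Integrable (Function.uncurry fun v u : ℝ =>
      (Real.exp (-(ε * Real.exp (1 * v)) + α * v) : ℂ) *
        hankel β (τ - Real.exp v) r a (Real.pi / 2) u) (volume.prod volume) := by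
    refine ((integrable_exp_neg_exp one_pos hε hα).mul_prod
      (integrable_exp_neg_exp hβ0 (half_pos hr) ha)).mono' ?_
      (Eventually.of_forall fun p => ?_)
    · refine Continuous.aestronglyMeasurable ?_
      unfold hankel
      fun_prop
    · simp only [Function.uncurry]
      rw [norm_mul, Complex.norm_real, Real.norm_of_nonneg (Real.exp_pos _).le]
      gcongr
      exact norm_hankel_le_of_mul_cos_nonpos hβ0.le hβ hr.le (by positivity)
        (by linarith) (by simp) a p.2
  simp_rw [← integral_const_mul]
  rw [integral_integral_swap hint]
  refine integral_congr_ae (Eventually.of_forall fun u => ?_)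
  simp only
  set c : ℂ := ε + Real.exp u * Complex.I with hc
  have hcre : 0 < c.re := by simpa [hc] using hε
  have hc0 : c ≠ 0 := fun h => by simp [h] at hcre
  have hlog : |(Complex.log c).im| < Real.pi / 2 := by
    rw [Complex.log_im]
    exact Complex.abs_arg_lt_pi_div_two_iff.2 (Or.inl hcre)
  rw [← integral_exp_neg_exp_complex hα hlog, ← integral_mul_const]
  refine integral_congr_ae (Eventually.of_forall fun v => ?_)
  simp only
  have h0 : Complex.exp (v + Complex.log c) = Complex.exp v * c := by
    rw [Complex.exp_add, Complex.exp_log hc0]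
  rw [h0, hankel, hankel, Complex.ofReal_exp, ← Complex.exp_add, ← Complex.exp_add,
    ← Complex.exp_add]
  congr 1
  have h1 : Complex.exp (u + (Real.pi / 2 : ℝ) * Complex.I) = Real.exp u * Complex.I := by
    rw [Complex.exp_add, Complex.exp_mul_I]
    simp
  rw [h1, hc]
  push_cast
  ring_nf

/-- From |ε + i e^u| ≥ e^u, the power is dominated by e^(-αu); its limit s^(-α) lowers a to a - α.
-/
lemma tendsto_integral_cpow_mul_hankel {α : ℝ} (hβ0 : 0 < β) (hβ : β ≤ 1 / 2) (hr : 0 < r)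
    (ha : α < a) (hα : 0 < α) (τ : ℝ) :
    Tendsto (fun ε : ℝ => ∫ u : ℝ, Complex.exp (-(α * Complex.log (ε + Real.exp u * Complex.I))) *
        hankel β τ r a (Real.pi / 2) u) (𝓝[>] 0)
      (𝓝 (∫ u, hankel β τ r (a - α) (Real.pi / 2) u)) := by
  have hpi := Real.pi_pos
  refine tendsto_integral_filter_of_dominated_convergence
    (fun u => Real.exp (-(r / 2 * Real.exp (β * u)) + (a - α) * u)) ?_ ?_
    (integrable_exp_neg_exp hβ0 (half_pos hr) (by linarith)) (Eventually.of_forall fun u => ?_)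
  · exact Eventually.of_forall fun ε => Measurable.aestronglyMeasurable
      (by have := (continuous_hankel β τ r a (Real.pi / 2)).measurable; fun_prop)
  · filter_upwards [self_mem_nhdsWithin] with ε hε
    refine Eventually.of_forall fun u => ?_
    have h1 := norm_hankel_le_of_mul_cos_nonpos hβ0.le hβ (τ := τ) hr.le (θ := Real.pi / 2)
      (by positivity) (by linarith) (by simp) a u
    have h2 : u ≤ Real.log ‖(ε : ℂ) + Real.exp u * Complex.I‖ := by
      rw [← Real.log_exp u]
      refine Real.log_le_log (Real.exp_pos u) ?_
      rw [Real.log_exp]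
      have := Complex.abs_im_le_norm ((ε : ℂ) + Real.exp u * Complex.I)
      simpa [abs_of_pos (Real.exp_pos u), -Complex.ofReal_exp] using this
    have h3 : ‖Complex.exp (-(α * Complex.log (ε + Real.exp u * Complex.I)))‖
        ≤ Real.exp (-(α * u)) := by
      rw [Complex.norm_exp, Complex.neg_re, Complex.re_ofReal_mul, Complex.log_re]
      gcongr
    rw [norm_mul]
    calc _ ≤ Real.exp (-(α * u)) * Real.exp (-(r / 2 * Real.exp (β * u)) + a * u) := by gcongr
      _ = _ := by
        rw [← Real.exp_add]
        congr 1
        ring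
  · have h1 : Complex.log (((0 : ℝ) : ℂ) + Real.exp u * Complex.I) = u + Real.pi / 2 * Complex.I := by
      rw [Complex.ofReal_zero, zero_add, Complex.log_ofReal_mul (Real.exp_pos u) Complex.I_ne_zero,
        Real.log_exp, Complex.log_I]
    have h2 : ContinuousAt (fun ε : ℝ => Complex.exp (-(α * Complex.log (ε + Real.exp u * Complex.I)))
        * hankel β τ r a (Real.pi / 2) u) 0 := by
      refine ContinuousAt.mul (ContinuousAt.cexp (ContinuousAt.neg (continuousAt_const.mul
        (ContinuousAt.clog (by fun_prop) ?_)))) continuousAt_const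
      exact Or.inr (by simp [(Real.exp_pos u).ne', -Complex.ofReal_exp])
    have h3 := h2.tendsto.mono_left (nhdsWithin_le_nhds (s := Ioi 0))
    rw [h1] at h3
    convert h3 using 2
    rw [hankel, hankel, ← Complex.exp_add]
    congr 1
    push_cast
    ring

/-- Riemann–Liouville integration raises the order of `wrightKernel`. -/
theorem integral_rpow_mul_wrightKernel {α ν τ : ℝ} (hβ0 : 0 < β) (hβ : β ≤ 1 / 2) (hr : 0 < r)
    (hα : 0 < α) (hν : ν + α < 1) (hτ : 0 < τ) :
    ∫ σ in Ioo 0 τ, (τ - σ) ^ (α - 1) * wrightKernel β ν r σ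
      = Real.Gamma α * wrightKernel β (ν + α) r τ := by
  have hpi := Real.pi_pos
  have ha : 0 < 1 - ν := by linarith
  set P : ℝ → ℝ := fun σ => (∫ u, hankel β σ r (1 - ν) (Real.pi / 2) u).im with hP
  set M := ∫ u : ℝ, Real.exp (-(r / 2 * Real.exp (β * u)) + (1 - ν) * u) with hM
  have hM0 : 0 ≤ M := integral_nonneg fun u => (Real.exp_pos _).le
  have hPM : ∀ σ, |P σ| ≤ M := fun σ => (Complex.abs_im_le_norm _).trans
    (norm_integral_hankel_imaginary_le hβ0 hβ hr ha σ)
  have hcont := continuous_integral_hankel_imaginary hβ0 hβ hr ha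
  have hPc : Continuous P := Complex.continuous_im.comp hcont
  have hP0 : ∀ σ ≤ 0, P σ = 0 := fun σ hσ =>
    im_integral_hankel_imaginary_of_nonpos hβ0 hβ hr ha hσ
  have hP1 : ∀ σ, 0 < σ → P σ = Real.pi * wrightKernel β ν r σ := fun σ hσ =>
    im_integral_hankel_imaginary_of_pos hβ0 hβ hr (by linarith) hσ
  have lim1 : Tendsto (fun ε : ℝ => ∫ v : ℝ, Real.exp (-(ε * Real.exp (1 * v)) + α * v) *
      P (τ - Real.exp v)) (𝓝[>] 0) (𝓝 (∫ v : ℝ, Real.exp (α * v) * P (τ - Real.exp v))) := by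
    refine tendsto_integral_filter_of_dominated_convergence
      -- The integrand lives on e^v < τ, where 1 ≤ e · exp(-e^v/τ).
      (fun v => (M * Real.exp 1) * Real.exp (-(1 / τ * Real.exp (1 * v)) + α * v)) ?_ ?_
      ((integrable_exp_neg_exp one_pos (by positivity) hα).const_mul _)
      (Eventually.of_forall fun v => ?_)
    · exact Eventually.of_forall fun ε => Continuous.aestronglyMeasurable (by fun_prop)
    · filter_upwards [self_mem_nhdsWithin] with ε hε
      refine Eventually.of_forall fun v => ?_
      rw [norm_mul, Real.norm_of_nonneg (Real.exp_pos _).le, Real.norm_eq_abs]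
      rcases le_or_gt τ (Real.exp v) with h | h
      · rw [hP0 _ (by linarith), abs_zero, mul_zero]
        positivity
      · have h1 : Real.exp (-(ε * Real.exp (1 * v)) + α * v)
            ≤ Real.exp 1 * Real.exp (-(1 / τ * Real.exp (1 * v)) + α * v) := by
          rw [← Real.exp_add]
          refine Real.exp_le_exp.2 ?_
          have h2 : 0 ≤ ε * Real.exp (1 * v) := mul_nonneg (le_of_lt hε) (Real.exp_pos _).le
          have h3 : 1 / τ * Real.exp (1 * v) ≤ 1 := by
            rw [one_mul, one_div_mul_eq_div, div_le_one hτ]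
            exact h.le
          linarith
        calc _ ≤ (Real.exp 1 * Real.exp (-(1 / τ * Real.exp (1 * v)) + α * v)) * M := by
              gcongr
              exact hPM _
          _ = _ := by ring
    · have : ContinuousAt (fun ε : ℝ => Real.exp (-(ε * Real.exp (1 * v)) + α * v) *
          P (τ - Real.exp v)) 0 := by fun_prop
      simpa using this.tendsto.mono_left (nhdsWithin_le_nhds (s := Ioi 0))
  have lim2 : Tendsto (fun ε : ℝ => ∫ v : ℝ, Real.exp (-(ε * Real.exp (1 * v)) + α * v) *
      P (τ - Real.exp v)) (𝓝[>] 0)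
      (𝓝 (Real.Gamma α * (Real.pi * wrightKernel β (ν + α) r τ))) := by
    have h1 := (Complex.continuous_im.tendsto _).comp ((tendsto_integral_cpow_mul_hankel (a := 1 - ν)
      hβ0 hβ hr (by linarith) hα τ).const_mul (Real.Gamma α : ℂ))
    rw [Complex.im_ofReal_mul, show 1 - ν - α = 1 - (ν + α) by ring,
      im_integral_hankel_imaginary_of_pos hβ0 hβ hr hν hτ] at h1
    refine h1.congr' ?_
    filter_upwards [self_mem_nhdsWithin] with ε hε
    simp only [Function.comp]
    rw [← integral_damped_hankel hβ0 hβ hr ha hα hε τ]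
    have hint : Integrable fun v : ℝ => (Real.exp (-(ε * Real.exp (1 * v)) + α * v) : ℂ) *
        ∫ u, hankel β (τ - Real.exp v) r (1 - ν) (Real.pi / 2) u := by
      refine ((integrable_exp_neg_exp one_pos hε hα).mul_const M).mono'
        (Continuous.aestronglyMeasurable (Continuous.mul (by fun_prop)
          (hcont.comp (by fun_prop)))) (Eventually.of_forall fun v => ?_)
      rw [norm_mul, Complex.norm_real, Real.norm_of_nonneg (Real.exp_pos _).le]
      gcongr
      exact norm_integral_hankel_imaginary_le hβ0 hβ hr ha _
    have := integral_im hint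
    simp only [RCLike.im_to_complex, Complex.im_ofReal_mul] at this
    exact this.symm
  have h := tendsto_nhds_unique lim1 lim2
  have h2 : ∫ v : ℝ, Real.exp (α * v) * P (τ - Real.exp v)
      = ∫ ρ in Ioi 0, ρ ^ (α - 1) * P (τ - ρ) := by
    rw [← integral_comp_exp]
    refine integral_congr_ae (Eventually.of_forall fun v => ?_)
    simp only [smul_eq_mul]
    rw [← mul_assoc, ← Real.exp_mul, ← Real.exp_add]
    congr 2
    ring
  -- Since P vanishes on the negative axis, the half-line integral is a convolution on (0, τ).
  have h3 : ∫ ρ in Ioi 0, ρ ^ (α - 1) * P (τ - ρ) = ∫ ρ in Ioo 0 τ, ρ ^ (α - 1) * P (τ - ρ) := by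
    refine setIntegral_eq_of_subset_of_forall_sdiff_eq_zero measurableSet_Ioi
      Ioo_subset_Ioi_self fun ρ hρ => ?_
    rw [hP0, mul_zero]
    by_contra hc
    exact hρ.2 ⟨hρ.1, by linarith⟩
  have h4 : ∫ ρ in Ioo 0 τ, ρ ^ (α - 1) * P (τ - ρ)
      = ∫ σ in Ioo 0 τ, (τ - σ) ^ (α - 1) * P σ := by
    rw [← integral_Ioc_eq_integral_Ioo, ← integral_Ioc_eq_integral_Ioo,
      ← intervalIntegral.integral_of_le hτ.le, ← intervalIntegral.integral_of_le hτ.le]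
    have := intervalIntegral.integral_comp_sub_left (a := 0) (b := τ)
      (fun σ => (τ - σ) ^ (α - 1) * P σ) τ
    simpa using this
  have h5 : ∫ σ in Ioo 0 τ, (τ - σ) ^ (α - 1) * P σ
      = Real.pi * ∫ σ in Ioo 0 τ, (τ - σ) ^ (α - 1) * wrightKernel β ν r σ := by
    rw [← integral_const_mul]
    refine setIntegral_congr_fun measurableSet_Ioo fun σ hσ => ?_
    simp only [hP1 σ hσ.1]
    ring
  rw [h2, h3, h4, h5] at h
  exact mul_left_cancel₀ hpi.ne' (h.trans (by ring))

end FractionalIntegral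

/-! ### Mellin transform and total mass -/

/-- The Mellin transform of the Wright function `z ↦ W (-z, -β, 1 - β)`. -/
lemma integral_rpow_mul_wright {β p : ℝ} (hβ0 : 0 < β) (hβ : β ≤ 1 / 2) (hp0 : 0 < p) (hp : p < 1) :
    ∫ z in Ioi 0, z ^ (p - 1) * wright (-z) (-β) (1 - β)
      = Real.Gamma p / Real.Gamma (1 - β * (1 - p)) := by
  have hpi := Real.pi_pos
  set θ : ℝ := 2 * Real.pi / 3 with hθ
  -- This exponent governs convergence at s = 0 and forces p < 1; the mass, at p = 1, is reached
  -- only as a limit.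
  have hb : 0 < β * (1 - p) := mul_pos hβ0 (by linarith)
  have hβθ0 : 0 ≤ β * θ := by positivity
  have hβθ : β * θ < Real.pi / 2 := by
    have : β * θ ≤ 1 / 2 * θ := by gcongr
    linarith
  set G : ℝ → ℂ := fun x => Complex.exp (-Complex.exp (x + (β * θ : ℝ) * Complex.I)
    + p * (x + (β * θ : ℝ) * Complex.I)) with hG
  set E : ℝ → ℂ := fun u => Complex.exp (Complex.exp (u + θ * Complex.I)
    + (β * (1 - p) : ℝ) * (u + θ * Complex.I)) with hE
  have hGint : Integrable G := by
    refine (integrable_exp_neg_exp one_pos (show 0 < Real.cos (β * θ) from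
      Real.cos_pos_of_mem_Ioo ⟨by linarith, hβθ⟩) hp0).mono'
      (Continuous.aestronglyMeasurable (by fun_prop)) (Eventually.of_forall fun x => ?_)
    rw [Complex.norm_exp]
    refine Real.exp_le_exp.2 ?_
    simp [Complex.exp_re]
    linarith
  have hEint : Integrable E := by
    refine (integrable_exp_neg_exp one_pos (show (0 : ℝ) < 1 / 2 by norm_num) hb).mono'
      (Continuous.aestronglyMeasurable (by fun_prop)) (Eventually.of_forall fun x => ?_)
    rw [Complex.norm_exp]
    refine Real.exp_le_exp.2 ?_
    simp [Complex.exp_re, hθ, cos_two_pi_div_three]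
    linarith
  -- With z = e^v, the shift v ↦ v + βu separates the double integral into a product of two Euler
  -- integrals.
  have hfac : ∀ v u : ℝ, (Real.exp (p * v) : ℂ) * hankel β 1 (Real.exp v) β θ u
      = G (v + β * u) * E u := by
    intro v u
    simp only [hG, hE, hankel]
    rw [Complex.ofReal_exp, Complex.ofReal_exp, ← Complex.exp_add, ← Complex.exp_add,
      ← Complex.exp_add]
    have h1 : ((v + β * u : ℝ) : ℂ) + (β * θ : ℝ) * Complex.I
        = v + β * (u + θ * Complex.I) := by
      push_cast; ring
    rw [h1]
    congr 1
    push_cast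
    ring
  have hprod : Integrable (Function.uncurry fun v u : ℝ => G (v + β * u) * E u)
      (volume.prod volume) := by
    rw [integrable_prod_iff' (Continuous.aestronglyMeasurable (by fun_prop))]
    refine ⟨Eventually.of_forall fun u => (hGint.comp_add_right (β * u)).mul_const (E u), ?_⟩
    simp only [Function.uncurry, norm_mul]
    have hinner : ∀ u : ℝ, ∫ v, ‖G (v + β * u)‖ * ‖E u‖ = (∫ v, ‖G v‖) * ‖E u‖ := fun u => by
      rw [integral_mul_const, integral_add_right_eq_self (fun v => ‖G v‖) (β * u)]
    simp_rw [hinner]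
    exact hEint.norm.const_mul _
  have hGval : ∫ x, G x = Real.Gamma p := by
    have := integral_exp_neg_exp_complex hp0 (w := (β * θ : ℝ) * Complex.I)
      (by rw [Complex.im_ofReal_mul, Complex.I_im, mul_one, abs_of_nonneg hβθ0]; exact hβθ)
    exact this
  have hswap : ∫ v, ∫ u, G (v + β * u) * E u
      = Real.Gamma p * (Real.Gamma (β * (1 - p)) *
        Complex.exp (Real.pi * (β * (1 - p) : ℝ) * Complex.I)) := by
    rw [integral_integral_swap hprod, ← integral_hankel_monomial hb]
    have hinner : ∀ u : ℝ, ∫ v, G (v + β * u) * E u = Real.Gamma p * E u := fun u => by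
      rw [integral_mul_const, integral_add_right_eq_self G (β * u), hGval]
    simp_rw [hinner]
    rw [integral_const_mul]
  have hint := hprod.integral_prod_left
  simp only [Function.uncurry] at hint
  have him := integral_im hint
  simp only [RCLike.im_to_complex] at him
  rw [hswap, Complex.im_ofReal_mul] at him
  calc ∫ z in Ioi 0, z ^ (p - 1) * wright (-z) (-β) (1 - β)
      = ∫ v, (∫ u, G (v + β * u) * E u).im / Real.pi := by
        rw [← integral_comp_exp]
        refine integral_congr_ae (Eventually.of_forall fun v => ?_)
        simp only [smul_eq_mul]
        rw [wright_neg_eq hβ0.le (by linarith) (by linarith), ← mul_assoc, ← Real.exp_mul,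
          ← Real.exp_add, ← mul_div_assoc, ← Complex.im_ofReal_mul, ← integral_const_mul]
        congr 3
        funext u
        rw [← hfac]
        congr 3
        · ring_nf
        · ring
    _ = Real.Gamma p * (((Real.Gamma (β * (1 - p)) : ℂ) *
        Complex.exp (Real.pi * (β * (1 - p) : ℝ) * Complex.I)).im / Real.pi) := by
        rw [integral_div, him, mul_div_assoc]
    _ = _ := by rw [im_gamma_mul_exp_div_pi hb, mul_one_div]

/-- The density `W (-z, -β, 1 - β)` on the half-line has total mass one. -/
lemma integral_wright_eq_one {β : ℝ} (hβ0 : 0 < β) (hβ : β ≤ 1 / 2) :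
    ∫ z in Ioi 0, wright (-z) (-β) (1 - β) = 1 := by
  have hν : 1 - β < 1 := by linarith
  obtain ⟨C, hC, h⟩ := exists_abs_wright_le hβ0 hβ hν
  -- For 1/2 < p < 1 the weight z^(p-1) is at most z^(-1/2) on (0, 1] and at most 1 beyond.
  have hbound : IntegrableOn (fun z : ℝ => C * ((Ioc 0 1).indicator (fun z => z ^ (-(1 / 2) : ℝ)) z
      + (1 + z ^ 2)⁻¹)) (Ioi 0) := by
    refine (Integrable.add ?_ integrable_inv_one_add_sq.integrableOn).const_mul C
    refine Integrable.integrableOn ((integrable_indicator_iff measurableSet_Ioc).2 ?_)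
    exact (intervalIntegrable_iff_integrableOn_Ioc_of_le zero_le_one).1
      (intervalIntegral.intervalIntegrable_rpow' (by norm_num))
  have lim1 : Tendsto (fun p : ℝ => ∫ z in Ioi 0, z ^ (p - 1) * wright (-z) (-β) (1 - β)) (𝓝[<] 1)
      (𝓝 (∫ z in Ioi 0, wright (-z) (-β) (1 - β))) := by
    refine tendsto_integral_filter_of_dominated_convergence _ ?_ ?_ hbound ?_
    · refine Eventually.of_forall fun p => Measurable.aestronglyMeasurable ?_
      have := (continuous_wright hβ0.le (by linarith) hν).measurable
      fun_prop
    · have : Ioo (1 / 2 : ℝ) 1 ∈ 𝓝[<] (1 : ℝ) := Ioo_mem_nhdsLT (by norm_num)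
      filter_upwards [this] with p hp
      filter_upwards [ae_restrict_mem measurableSet_Ioi] with z hz
      have hz0 : 0 < z := hz
      rw [norm_mul, Real.norm_of_nonneg (by positivity), Real.norm_eq_abs]
      have h1 := h z hz0.le
      have h2 : C / (1 + z ^ 2) ≤ C := div_le_self hC (by nlinarith)
      rcases le_or_gt z 1 with hz1 | hz1
      · rw [indicator_of_mem (show z ∈ Ioc 0 1 from ⟨hz0, hz1⟩)]
        have h3 : z ^ (p - 1) ≤ z ^ (-(1 / 2) : ℝ) :=
          Real.rpow_le_rpow_of_exponent_ge hz0 hz1 (by linarith [hp.1])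
        calc z ^ (p - 1) * |wright (-z) (-β) (1 - β)| ≤ z ^ (-(1 / 2) : ℝ) * C := by
              gcongr
              exact h1.trans h2
          _ ≤ _ := by
              have : 0 ≤ C * (1 + z ^ 2)⁻¹ := by positivity
              linarith
      · rw [indicator_of_notMem (fun hm => absurd hm.2 (not_le.2 hz1)), zero_add]
        have h3 : z ^ (p - 1) ≤ 1 :=
          Real.rpow_le_one_of_one_le_of_nonpos hz1.le (by linarith [hp.2])
        calc z ^ (p - 1) * |wright (-z) (-β) (1 - β)| ≤ 1 * (C / (1 + z ^ 2)) := by gcongr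
          _ = _ := by rw [one_mul, div_eq_mul_inv]
    · filter_upwards [ae_restrict_mem measurableSet_Ioi] with z hz
      have hz0 : 0 < z := hz
      have : ContinuousAt (fun p : ℝ => z ^ (p - 1) * wright (-z) (-β) (1 - β)) 1 :=
        ((Real.continuousAt_const_rpow hz0.ne').comp (f := fun p : ℝ => p - 1)
          (by fun_prop)).mul continuousAt_const
      simpa using this.tendsto.mono_left (nhdsWithin_le_nhds (s := Iio 1))
  have hΓ : ContinuousAt Real.Gamma 1 :=
    (Real.differentiableAt_Gamma fun m h => by
      have : (0 : ℝ) ≤ m := Nat.cast_nonneg m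
      linarith).continuousAt
  have lim2 : Tendsto (fun p : ℝ => Real.Gamma p / Real.Gamma (1 - β * (1 - p))) (𝓝[<] 1)
      (𝓝 1) := by
    have h1 : Tendsto (fun p : ℝ => Real.Gamma (1 - β * (1 - p))) (𝓝 1) (𝓝 (Real.Gamma 1)) := by
      refine hΓ.tendsto.comp ?_
      have : ContinuousAt (fun p : ℝ => 1 - β * (1 - p)) 1 := by fun_prop
      simpa using this.tendsto
    have h2 := hΓ.tendsto.div h1 (by simp)
    rw [Real.Gamma_one, div_one] at h2
    exact h2.mono_left nhdsWithin_le_nhds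
  refine tendsto_nhds_unique lim1 (lim2.congr' ?_)
  have : Ioo (0 : ℝ) 1 ∈ 𝓝[<] (1 : ℝ) := Ioo_mem_nhdsLT (by norm_num)
  filter_upwards [this] with p hp
  exact (integral_rpow_mul_wright hβ0 hβ hp.1 hp.2).symm

/-! ### Functions with vanishing unit averages -/

section UnitAverages

variable {f : ℝ → ℝ}

lemma inv_one_add_sq_le_shift (y : ℝ) {s : ℝ} (hs : |s| ≤ 1) :
    (1 + y ^ 2)⁻¹ ≤ 3 * (1 + (y + s) ^ 2)⁻¹ := by
  have hs2 : s ^ 2 ≤ 1 := by rw [sq_le_one_iff_abs_le_one]; exact hs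
  rw [← div_eq_mul_inv, ← one_div, div_le_div_iff₀ (by positivity) (by positivity)]
  nlinarith [sq_nonneg (y - s)]

lemma continuous_unit_average (hf : Continuous f) :
    Continuous fun x => ∫ η in x..(x + 1), |f η| := by
  have h : ∀ x, ∫ η in x..(x + 1), |f η| = ∫ s in (0 : ℝ)..1, |f (x + s)| := fun x => by
    rw [intervalIntegral.integral_comp_add_left (fun η => |f η|), add_zero]
  simp_rw [h]
  exact intervalIntegral.continuous_parametric_intervalIntegral_of_continuous' (by fun_prop) 0 1

lemma exists_unit_average_le (hf : Continuous f)
    (hf0 : Tendsto (fun x => ∫ η in x..(x + 1), |f η|) (cocompact ℝ) (𝓝 0)) :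
    ∃ B, ∀ x, ‖∫ η in x..(x + 1), |f η|‖ ≤ B := by
  let F : ZeroAtInftyContinuousMap ℝ ℝ := ⟨⟨_, continuous_unit_average hf⟩, hf0⟩
  obtain ⟨B, hB⟩ := isBounded_iff_forall_norm_le.1 (ZeroAtInftyContinuousMap.isBounded_range F)
  exact ⟨B, fun x => hB _ ⟨x, rfl⟩⟩

lemma integrable_unit_average_prod (hf : Continuous f)
    (hf0 : Tendsto (fun x => ∫ η in x..(x + 1), |f η|) (cocompact ℝ) (𝓝 0)) (x : ℝ) :
    Integrable (Function.uncurry fun ξ s : ℝ => (1 + (x - ξ) ^ 2)⁻¹ * |f (ξ + s)|)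
      (volume.prod (volume.restrict (Ioc 0 1))) := by
  have hk : Continuous fun ξ : ℝ => (1 + (x - ξ) ^ 2)⁻¹ :=
    Continuous.inv₀ (by fun_prop) fun ξ => by positivity
  have hcont : Continuous (Function.uncurry fun ξ s : ℝ => (1 + (x - ξ) ^ 2)⁻¹ * |f (ξ + s)|) :=
    (hk.comp continuous_fst).mul (by fun_prop)
  rw [integrable_prod_iff hcont.aestronglyMeasurable]
  constructor
  · refine Eventually.of_forall fun ξ => ?_
    have : Continuous fun s : ℝ => (1 + (x - ξ) ^ 2)⁻¹ * |f (ξ + s)| := by fun_prop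
    exact (this.integrableOn_Icc).mono_set Ioc_subset_Icc_self
  · have h : ∀ ξ, ∫ s in Ioc (0 : ℝ) 1, ‖(1 + (x - ξ) ^ 2)⁻¹ * |f (ξ + s)|‖
        = (∫ η in ξ..(ξ + 1), |f η|) * (1 + (x - ξ) ^ 2)⁻¹ := by
      intro ξ
      have e : ∫ η in ξ..(ξ + 1), |f η| = ∫ s in Ioc (0 : ℝ) 1, |f (ξ + s)| := by
        rw [← intervalIntegral.integral_of_le zero_le_one,
          intervalIntegral.integral_comp_add_left (fun η => |f η|), add_zero]
      rw [e, mul_comm, ← integral_const_mul]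
      refine integral_congr_ae (Eventually.of_forall fun s => ?_)
      simp only [norm_mul, norm_inv, Real.norm_eq_abs, abs_abs]
      rw [abs_of_pos (by positivity)]
    simp only [Function.uncurry]
    simp_rw [h]
    obtain ⟨B, hB⟩ := exists_unit_average_le hf hf0
    exact (integrable_inv_one_add_sq.comp_sub_left x).bdd_mul
      (continuous_unit_average hf).aestronglyMeasurable (Eventually.of_forall hB)

/-- The weight changes by at most a factor 3 under a shift s in (0, 1]. Averaging over s replaces
|f| by its unit averages, which are bounded. -/
lemma inv_one_add_sq_mul_integrable_and_le (hf : Continuous f)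
    (hf0 : Tendsto (fun x => ∫ η in x..(x + 1), |f η|) (cocompact ℝ) (𝓝 0)) (x : ℝ) :
    Integrable (fun η => (1 + (x - η) ^ 2)⁻¹ * |f η|) ∧
      ∫ η, (1 + (x - η) ^ 2)⁻¹ * |f η|
        ≤ 3 * ∫ ξ, (1 + ξ ^ 2)⁻¹ * ∫ η in (x - ξ)..(x - ξ + 1), |f η| := by
  have hprod := integrable_unit_average_prod hf hf0 x
  have hae := hprod.prod_left_ae
  have hle : ∀ s ∈ Ioc (0 : ℝ) 1, ∀ η, (1 + (x - η) ^ 2)⁻¹ * |f η|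
      ≤ 3 * ((1 + (x - (η - s)) ^ 2)⁻¹ * |f (η - s + s)|) := by
    intro s hs η
    have := inv_one_add_sq_le_shift (x - η) (s := s) (by rw [abs_of_pos hs.1]; exact hs.2)
    rw [sub_add_cancel, ← mul_assoc, show x - (η - s) = x - η + s by ring]
    gcongr
  have hk : Continuous fun η : ℝ => (1 + (x - η) ^ 2)⁻¹ * |f η| :=
    (Continuous.inv₀ (by fun_prop) fun ξ => by positivity).mul (by fun_prop)
  have hboth : ∀ᵐ s ∂(volume.restrict (Ioc (0 : ℝ) 1)),
      Integrable (fun η => (1 + (x - η) ^ 2)⁻¹ * |f η|) ∧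
      ∫ η, (1 + (x - η) ^ 2)⁻¹ * |f η| ≤ 3 * ∫ ξ, (1 + (x - ξ) ^ 2)⁻¹ * |f (ξ + s)| := by
    filter_upwards [hae, ae_restrict_mem measurableSet_Ioc] with s hs hs1
    have hs' : Integrable fun ξ => (1 + (x - ξ) ^ 2)⁻¹ * |f (ξ + s)| := hs
    have h1 := (hs'.comp_sub_right s).const_mul 3
    have h2 : Integrable (fun η => (1 + (x - η) ^ 2)⁻¹ * |f η|) := by
      refine h1.mono' hk.aestronglyMeasurable (Eventually.of_forall fun η => ?_)
      rw [Real.norm_of_nonneg (by positivity)]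
      exact hle s hs1 η
    refine ⟨h2, ?_⟩
    rw [← integral_sub_right_eq_self (fun ξ => (1 + (x - ξ) ^ 2)⁻¹ * |f (ξ + s)|) s,
      ← integral_const_mul]
    exact integral_mono h2 h1 (hle s hs1)
  have hne : (ae (volume.restrict (Ioc (0 : ℝ) 1))).NeBot := by
    rw [ae_neBot]
    intro h
    have := congrArg (fun m => m univ) h
    simp at this
  -- Integrability does not involve s, so one good s suffices.
  refine ⟨hboth.exists.choose_spec.1, ?_⟩
  have hconst : ∫ η, (1 + (x - η) ^ 2)⁻¹ * |f η| = ∫ _ in Ioc (0 : ℝ) 1,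
      ∫ η, (1 + (x - η) ^ 2)⁻¹ * |f η| := by simp
  rw [hconst]
  calc _ ≤ ∫ s in Ioc (0 : ℝ) 1, 3 * ∫ ξ, (1 + (x - ξ) ^ 2)⁻¹ * |f (ξ + s)| := by
        refine integral_mono_ae (integrable_const _) (hprod.integral_prod_right.const_mul 3) ?_
        filter_upwards [hboth] with s hs
        exact hs.2
    _ = 3 * ∫ ξ, ∫ s in Ioc (0 : ℝ) 1, (1 + (x - ξ) ^ 2)⁻¹ * |f (ξ + s)| := by
        rw [integral_const_mul, integral_integral_swap hprod]
    _ = 3 * ∫ ξ, (1 + ξ ^ 2)⁻¹ * ∫ η in (x - ξ)..(x - ξ + 1), |f η| := by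
        rw [← integral_sub_left_eq_self _ volume x]
        congr 2
        funext ξ
        rw [integral_const_mul, sub_sub_cancel, ← intervalIntegral.integral_of_le zero_le_one,
          intervalIntegral.integral_comp_add_left (fun η => |f η|), add_zero]

lemma tendsto_integral_inv_one_add_sq (hf : Continuous f)
    (hf0 : Tendsto (fun x => ∫ η in x..(x + 1), |f η|) (cocompact ℝ) (𝓝 0)) :
    Tendsto (fun x => ∫ η, (1 + (x - η) ^ 2)⁻¹ * |f η|) (cocompact ℝ) (𝓝 0) := by
  have h : Tendsto (fun x => ∫ ξ, (1 + ξ ^ 2)⁻¹ * ∫ η in (x - ξ)..(x - ξ + 1), |f η|)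
      (cocompact ℝ) (𝓝 (∫ ξ : ℝ, (1 + ξ ^ 2)⁻¹ * 0)) := by
    obtain ⟨B, hB⟩ := exists_unit_average_le hf hf0
    have : (cocompact ℝ).IsCountablyGenerated := by
      rw [cocompact_eq_atBot_atTop]
      infer_instance
    refine tendsto_integral_filter_of_dominated_convergence (fun ξ => (1 + ξ ^ 2)⁻¹ * B)
      (Eventually.of_forall fun x => Continuous.aestronglyMeasurable ?_)
      (Eventually.of_forall fun x => Eventually.of_forall fun ξ => ?_)
      (integrable_inv_one_add_sq.mul_const B) (Eventually.of_forall fun ξ => ?_)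
    · exact (Continuous.inv₀ (by fun_prop) fun ξ => by positivity).mul
        ((continuous_unit_average hf).comp (by fun_prop : Continuous fun ξ : ℝ => x - ξ))
    · rw [norm_mul, Real.norm_of_nonneg (by positivity : (0 : ℝ) ≤ (1 + ξ ^ 2)⁻¹)]
      gcongr
      exact hB _
    · have h1 := (Homeomorph.subRight ξ).isClosedEmbedding.tendsto_cocompact
      exact (hf0.comp h1).const_mul _
  have h2 := h.const_mul 3
  simp only [mul_zero, integral_zero] at h2
  exact squeeze_zero (fun x => integral_nonneg fun η => by positivity)
    (fun x => (inv_one_add_sq_mul_integrable_and_le hf hf0 x).2) h2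

end UnitAverages

/-! ### Convolution with quadratically decaying kernels -/

section Convolution

variable {f k k' : ℝ → ℝ} {C : ℝ}

lemma integrable_conv (hf : Continuous f)
    (hJ : ∀ x, Integrable (fun η => (1 + (x - η) ^ 2)⁻¹ * |f η|)) (hk : Measurable k)
    (hkC : ∀ y, |k y| ≤ C * (1 + y ^ 2)⁻¹) (x : ℝ) : Integrable fun η => k (x - η) * f η := by
  refine ((hJ x).const_mul C).mono'
    (by have := hf.measurable; exact Measurable.aestronglyMeasurable (by fun_prop))
    (Eventually.of_forall fun η => ?_)
  rw [norm_mul, Real.norm_eq_abs, Real.norm_eq_abs, ← mul_assoc]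
  gcongr
  exact hkC _

lemma abs_conv_le_near (hC : 0 ≤ C) (hkC : ∀ y, |k y| ≤ C * (1 + y ^ 2)⁻¹) {x x₀ : ℝ}
    (hx : x ∈ Metric.ball x₀ 1) (η : ℝ) :
    ‖k (x - η) * f η‖ ≤ C * 3 * ((1 + (x₀ - η) ^ 2)⁻¹ * |f η|) := by
  rw [norm_mul, Real.norm_eq_abs, Real.norm_eq_abs, ← mul_assoc]
  gcongr
  refine (hkC _).trans ?_
  rw [mul_assoc]
  gcongr
  rw [Metric.mem_ball, Real.dist_eq, abs_sub_comm] at hx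
  have := inv_one_add_sq_le_shift (x - η) hx.le
  rwa [show x - η + (x₀ - x) = x₀ - η by ring] at this

lemma continuous_conv (hf : Continuous f)
    (hJ : ∀ x, Integrable (fun η => (1 + (x - η) ^ 2)⁻¹ * |f η|)) (hk : Continuous k) (hC : 0 ≤ C)
    (hkC : ∀ y, |k y| ≤ C * (1 + y ^ 2)⁻¹) : Continuous fun x => ∫ η, k (x - η) * f η := by
  refine continuous_iff_continuousAt.2 fun x₀ => ?_
  refine continuousAt_of_dominated (bound := fun η => C * 3 * ((1 + (x₀ - η) ^ 2)⁻¹ * |f η|))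
    (Eventually.of_forall fun x => Continuous.aestronglyMeasurable (by fun_prop)) ?_
    ((hJ x₀).const_mul _) (Eventually.of_forall fun η => by fun_prop)
  filter_upwards [Metric.ball_mem_nhds x₀ one_pos] with x hx
  exact Eventually.of_forall fun η => abs_conv_le_near hC hkC hx η

lemma hasDerivAt_conv (hf : Continuous f)
    (hJ : ∀ x, Integrable (fun η => (1 + (x - η) ^ 2)⁻¹ * |f η|)) (hk : ∀ y, HasDerivAt k (k' y) y)
    (hk' : Continuous k') (hC : 0 ≤ C) (hkC : ∀ y, |k y| ≤ C * (1 + y ^ 2)⁻¹)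
    (hkC' : ∀ y, |k' y| ≤ C * (1 + y ^ 2)⁻¹) (x₀ : ℝ) :
    HasDerivAt (fun x => ∫ η, k (x - η) * f η) (∫ η, k' (x₀ - η) * f η) x₀ := by
  have hkc : Continuous k := continuous_iff_continuousAt.2 fun y => (hk y).continuousAt
  refine (hasDerivAt_integral_of_dominated_loc_of_deriv_le
    (F := fun x η => k (x - η) * f η) (F' := fun x η => k' (x - η) * f η)
    (Metric.ball_mem_nhds x₀ one_pos)
    (Eventually.of_forall fun x => Continuous.aestronglyMeasurable (by fun_prop))
    (integrable_conv hf hJ hkc.measurable hkC x₀) (Continuous.aestronglyMeasurable (by fun_prop))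
    (Eventually.of_forall fun η x hx => abs_conv_le_near hC hkC' hx η)
    ((hJ x₀).const_mul _) (Eventually.of_forall fun η x _ => ?_)).2
  exact ((hk (x - η)).comp_sub_const x η).mul_const _

end Convolution

/-! ### Differentiability of even and odd extensions -/

section EvenOdd

/-- The vanishing slope at 0 removes the corner of |y|. -/
lemma hasDerivAt_comp_abs {φ φ' : ℝ → ℝ} (h : ∀ z, HasDerivAt φ (φ' z) z) (h0 : φ' 0 = 0) (y : ℝ) :
    HasDerivAt (fun y => φ |y|) (SignType.sign y * φ' |y|) y := by
  rcases eq_or_ne y 0 with rfl | hy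
  · have h1 := (hasDerivAt_iff_isLittleO.1 (h 0))
    have h2 : Tendsto (fun y : ℝ => |y|) (𝓝 0) (𝓝 0) := by
      simpa using (continuous_abs (G := ℝ)).tendsto 0
    refine hasDerivAt_iff_isLittleO.2 ?_
    have h3 := h1.comp_tendsto h2
    simp only [h0, sub_zero, smul_zero, Function.comp_def] at h3
    have h4 := h3.trans_isBigO (Asymptotics.isBigO_of_le (𝓝 0) (g := fun y : ℝ => y) (by simp))
    simpa [h0] using h4
  · exact ((h |y|).comp y (hasDerivAt_abs hy)).congr_deriv (mul_comm _ _)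

/-- The odd extension is differentiable at 0 because ψ(0) = 0 rules out a jump; it serves for the
second derivative of an even kernel. -/
lemma hasDerivAt_sign_mul_comp_abs {ψ ψ' : ℝ → ℝ} (h : ∀ z, HasDerivAt ψ (ψ' z) z) (h0 : ψ 0 = 0)
    (y : ℝ) : HasDerivAt (fun y => SignType.sign y * ψ |y|) (ψ' |y|) y := by
  rcases lt_trichotomy y 0 with hy | rfl | hy
  · have h1 : HasDerivAt (fun y => -ψ (-y)) (ψ' |y|) y := by
      have := ((h (-y)).comp y (hasDerivAt_neg y)).neg
      rw [abs_of_neg hy]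
      exact this.congr_deriv (by simp)
    refine h1.congr_of_eventuallyEq ?_
    filter_upwards [Iio_mem_nhds hy] with z hz
    simp [sign_neg (show z < 0 from hz), abs_of_neg (show z < 0 from hz)]
  · refine hasDerivAt_iff_isLittleO.2 ?_
    have h1 := (hasDerivAt_iff_isLittleO.1 (h 0))
    have h2 : Tendsto (fun y : ℝ => |y|) (𝓝 0) (𝓝 0) := by
      simpa using (continuous_abs (G := ℝ)).tendsto 0
    have h3 := h1.comp_tendsto h2
    simp only [h0, sub_zero, Function.comp_def] at h3
    refine (Asymptotics.IsBigO.trans_isLittleO (g := fun y => ψ |y| - |y| • ψ' 0)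
      (Asymptotics.isBigO_of_le _ fun z => ?_) h3).trans_isBigO
      (Asymptotics.isBigO_of_le _ (by simp))
    rcases lt_trichotomy z 0 with hz | rfl | hz
    · simp only [sign_neg hz, abs_of_neg hz, abs_zero, h0, smul_eq_mul, mul_zero, sub_zero]
      rw [← norm_neg]
      refine le_of_eq (congrArg _ ?_)
      simp
      ring
    · simp [h0]
    · simp [sign_pos hz, abs_of_pos hz]
  · refine (((h y).congr_deriv (by rw [abs_of_pos hy]))).congr_of_eventuallyEq ?_
    filter_upwards [Ioi_mem_nhds hy] with z hz
    simp [sign_pos (show 0 < z from hz), abs_of_pos (show 0 < z from hz)]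

end EvenOdd

/-! ### Calculus of the kernel -/

section Kernel

variable {β ν : ℝ}

lemma wright_zero_left (μ ν : ℝ) : wright 0 μ ν = 1 / Real.Gamma ν := by
  rw [wright, tsum_eq_single 0 (fun j hj => by simp [hj])]
  simp

lemma hasDerivAt_wrightKernel_left (hβ0 : 0 ≤ β) (hβ : β < 1) (hν : ν < 1) {τ : ℝ} (hτ : 0 < τ)
    (r : ℝ) : HasDerivAt (fun r => wrightKernel β ν r τ) (-wrightKernel β (ν - β) r τ) r := by
  have h := ((hasDerivAt_wright hβ0 hβ hν (r / τ ^ β)).comp r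
    ((hasDerivAt_id r).div_const (τ ^ β))).const_mul (τ ^ (ν - 1))
  refine h.congr_deriv ?_
  have hp : τ ^ (ν - β - 1) = τ ^ (ν - 1) / τ ^ β := by
    rw [← Real.rpow_sub hτ]; congr 1; ring
  simp only [wrightKernel]
  rw [hp]
  ring

/-- The product rule gives the left side of `wright_contiguous`, which collapses to one kernel. -/
lemma hasDerivAt_wrightKernel_right (hβ0 : 0 ≤ β) (hβ : β < 1) (hν : ν < 1) {τ : ℝ} (hτ : 0 < τ)
    (r : ℝ) : HasDerivAt (fun τ => wrightKernel β ν r τ) (wrightKernel β (ν - 1) r τ) τ := by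
  have hτβ : τ ^ β ≠ 0 := (Real.rpow_pos_of_pos hτ β).ne'
  have h1 : HasDerivAt (fun τ : ℝ => r / τ ^ β) (-(β * (r / τ ^ β) / τ)) τ := by
    have := ((Real.hasDerivAt_rpow_const (p := β) (Or.inl hτ.ne')).fun_inv hτβ).const_mul r
    refine (this.congr_deriv ?_)
    rw [Real.rpow_sub_one hτ.ne']
    field_simp
  have h2 := ((hasDerivAt_wright hβ0 hβ hν (r / τ ^ β)).comp τ h1)
  have h3 := (Real.hasDerivAt_rpow_const (p := ν - 1) (Or.inl hτ.ne')).mul h2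
  refine h3.congr_deriv ?_
  have hc := wright_contiguous hβ0 hβ hν (r / τ ^ β)
  simp only [wrightKernel, Function.comp]
  rw [← hc, Real.rpow_sub_one hτ.ne']
  ring

lemma measurable_wrightKernel (hβ0 : 0 ≤ β) (hβ : β < 1) (hν : ν < 1) :
    Measurable fun p : ℝ × ℝ => wrightKernel β ν p.1 p.2 := by
  have := (continuous_wright hβ0 hβ hν).measurable
  unfold wrightKernel
  exact (by fun_prop : Measurable fun p : ℝ × ℝ => p.2 ^ (ν - 1)).mul
    (this.comp (by fun_prop : Measurable fun p : ℝ × ℝ => p.1 / p.2 ^ β))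

lemma continuous_wrightKernel (hβ0 : 0 ≤ β) (hβ : β < 1) (hν : ν < 1) {τ : ℝ} (hτ : 0 < τ) :
    Continuous fun r => wrightKernel β ν r τ :=
  continuous_iff_continuousAt.2 fun r =>
    (hasDerivAt_wrightKernel_left hβ0 hβ hν hτ r).continuousAt

/-- The decay in |y|/(c τ^β) is split into a factor in τ and a fixed weight in y, so that one
integrable weight serves all times. -/
lemma exists_abs_wrightKernel_le (hβ0 : 0 < β) (hβ : β ≤ 1 / 2) (hν : ν < 1) {c : ℝ} (hc : 0 < c) :
    ∃ C, 0 ≤ C ∧ ∀ τ, 0 < τ → ∀ y, |wrightKernel β ν (|y| / c) τ|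
      ≤ C * (τ ^ (ν - 1) * (1 + (τ ^ β) ^ 2)) * (1 + y ^ 2)⁻¹ := by
  obtain ⟨C, hC, h⟩ := exists_abs_wright_le hβ0 hβ hν
  refine ⟨C * (1 + c ^ 2), by positivity, fun τ hτ y => ?_⟩
  have hT : 0 < τ ^ β := Real.rpow_pos_of_pos hτ β
  have hS : 0 < τ ^ (ν - 1) := Real.rpow_pos_of_pos hτ _
  rw [wrightKernel, abs_mul, abs_of_pos hS]
  have h1 := h (|y| / c / τ ^ β) (by positivity)
  have h2 : C / (1 + (|y| / c / τ ^ β) ^ 2) ≤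
      C * ((1 + c ^ 2) * (1 + (τ ^ β) ^ 2) * (1 + y ^ 2)⁻¹) := by
    rw [div_eq_mul_inv]
    gcongr
    rw [← div_eq_mul_inv, ← one_div, div_le_div_iff₀ (by positivity) (by positivity), div_div,
      div_pow, sq_abs]
    have h3 : y ^ 2 = (c * τ ^ β) ^ 2 * (y ^ 2 / (c * τ ^ β) ^ 2) := by field_simp
    have h4 : 0 ≤ y ^ 2 / (c * τ ^ β) ^ 2 := by positivity
    generalize y ^ 2 / (c * τ ^ β) ^ 2 = q at h3 h4
    have h5 : (1 + c ^ 2) * (1 + (τ ^ β) ^ 2) = 1 + c ^ 2 + (τ ^ β) ^ 2 + (c * τ ^ β) ^ 2 := by ring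
    rw [h5, h3]
    nlinarith [mul_nonneg (sq_nonneg c) h4, mul_nonneg (sq_nonneg (τ ^ β)) h4, sq_nonneg c,
      sq_nonneg (τ ^ β), sq_nonneg (c * τ ^ β)]
  calc _ ≤ τ ^ (ν - 1) * (C * ((1 + c ^ 2) * (1 + (τ ^ β) ^ 2) * (1 + y ^ 2)⁻¹)) := by
        gcongr
        exact h1.trans h2
    _ = _ := by ring

end Kernel

/-! ### The potential and its derivatives -/

section Potential

variable {β c : ℝ} {f : ℝ → ℝ}

/-- The convolution in space of `f` with the kernel `wrightKernel β ν (|x| / c) τ`. -/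
noncomputable def wrightPotential (β c : ℝ) (f : ℝ → ℝ) (ν x τ : ℝ) : ℝ :=
  ∫ η, wrightKernel β ν (|x - η| / c) τ * f η

lemma measurable_wrightKernel_abs_sub {ν : ℝ} (hβ0 : 0 ≤ β) (hβ : β < 1) (hν : ν < 1) (x : ℝ) :
    Measurable fun p : ℝ × ℝ => wrightKernel β ν (|x - p.2| / c) p.1 :=
  (measurable_wrightKernel hβ0 hβ hν).comp
    (by fun_prop : Measurable fun p : ℝ × ℝ => (|x - p.2| / c, p.1))

lemma integrable_wrightKernel_mul {ν : ℝ} (hβ0 : 0 < β) (hβ : β ≤ 1 / 2) (hν : ν < 1) (hc : 0 < c)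
    (hf : Continuous f) (hJ : ∀ x, Integrable (fun η => (1 + (x - η) ^ 2)⁻¹ * |f η|))
    (x : ℝ) {τ : ℝ} (hτ : 0 < τ) :
    Integrable fun η => wrightKernel β ν (|x - η| / c) τ * f η := by
  obtain ⟨C, hC, h⟩ := exists_abs_wrightKernel_le hβ0 hβ hν hc
  exact integrable_conv (k := fun y => wrightKernel β ν (|y| / c) τ) hf hJ
    (((continuous_wrightKernel hβ0.le (by linarith) hν hτ).comp
      (by fun_prop : Continuous fun y : ℝ => |y| / c)).measurable) (h τ hτ) x

lemma exists_abs_wrightPotential_le {ν : ℝ} (hβ0 : 0 < β) (hβ : β ≤ 1 / 2) (hν : ν < 1) (hc : 0 < c)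
    (hJ : ∀ x, Integrable (fun η => (1 + (x - η) ^ 2)⁻¹ * |f η|)) :
    ∃ C, 0 ≤ C ∧ ∀ τ, 0 < τ → ∀ x, |wrightPotential β c f ν x τ|
      ≤ C * (τ ^ (ν - 1) * (1 + (τ ^ β) ^ 2)) * ∫ η, (1 + (x - η) ^ 2)⁻¹ * |f η| := by
  obtain ⟨C, hC, h⟩ := exists_abs_wrightKernel_le hβ0 hβ hν hc
  refine ⟨C, hC, fun τ hτ x => ?_⟩
  rw [← integral_const_mul, ← Real.norm_eq_abs]
  refine norm_integral_le_of_norm_le ((hJ x).const_mul _) (Eventually.of_forall fun η => ?_)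
  rw [norm_mul, Real.norm_eq_abs, Real.norm_eq_abs, ← mul_assoc]
  gcongr
  exact h τ hτ _

lemma tendsto_wrightPotential_cocompact {ν : ℝ} (hβ0 : 0 < β) (hβ : β ≤ 1 / 2) (hν : ν < 1)
    (hc : 0 < c) (hJ : ∀ x, Integrable (fun η => (1 + (x - η) ^ 2)⁻¹ * |f η|))
    (hJ0 : Tendsto (fun x => ∫ η, (1 + (x - η) ^ 2)⁻¹ * |f η|) (cocompact ℝ) (𝓝 0))
    {τ : ℝ} (hτ : 0 < τ) : Tendsto (fun x => wrightPotential β c f ν x τ) (cocompact ℝ) (𝓝 0) := by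
  obtain ⟨C, hC, h⟩ := exists_abs_wrightPotential_le hβ0 hβ hν hc hJ
  refine squeeze_zero_norm (fun x => h τ hτ x) ?_
  simpa using hJ0.const_mul (C * (τ ^ (ν - 1) * (1 + (τ ^ β) ^ 2)))

lemma hasDerivAt_wrightPotential_time {ν : ℝ} (hβ0 : 0 < β) (hβ : β ≤ 1 / 2) (hν : ν < 1)
    (hc : 0 < c) (hf : Continuous f) (hJ : ∀ x, Integrable (fun η => (1 + (x - η) ^ 2)⁻¹ * |f η|))
    (x : ℝ) {τ : ℝ} (hτ : 0 < τ) :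
    HasDerivAt (fun τ => wrightPotential β c f ν x τ) (wrightPotential β c f (ν - 1) x τ) τ := by
  obtain ⟨C, hC, h⟩ := exists_abs_wrightKernel_le hβ0 hβ (show ν - 1 < 1 by linarith) hc
  -- On this neighbourhood the negative power of t is controlled by the left end and t^β by the
  -- right end.
  have hs : Ioo (τ / 2) (2 * τ) ∈ 𝓝 τ := Ioo_mem_nhds (by linarith) (by linarith)
  refine (hasDerivAt_integral_of_dominated_loc_of_deriv_le
    (F := fun τ η => wrightKernel β ν (|x - η| / c) τ * f η)
    (F' := fun τ η => wrightKernel β (ν - 1) (|x - η| / c) τ * f η)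
    (bound := fun η => C * ((τ / 2) ^ (ν - 1 - 1) * (1 + ((2 * τ) ^ β) ^ 2)) *
      ((1 + (x - η) ^ 2)⁻¹ * |f η|))
    hs ?_ (integrable_wrightKernel_mul hβ0 hβ hν hc hf hJ x hτ)
    (integrable_wrightKernel_mul hβ0 hβ (by linarith) hc hf hJ x hτ).aestronglyMeasurable
    (Eventually.of_forall fun η t ht => ?_) ((hJ x).const_mul _)
    (Eventually.of_forall fun η t ht => ?_)).2
  · filter_upwards [hs] with t ht
    exact (integrable_wrightKernel_mul hβ0 hβ hν hc hf hJ x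
      (by linarith [ht.1])).aestronglyMeasurable
  · have ht0 : 0 < t := by linarith [ht.1]
    rw [norm_mul, Real.norm_eq_abs, Real.norm_eq_abs, ← mul_assoc]
    gcongr
    refine (h t ht0 _).trans ?_
    have h1 : t ^ (ν - 1 - 1) ≤ (τ / 2) ^ (ν - 1 - 1) :=
      Real.rpow_le_rpow_of_nonpos (by linarith) ht.1.le (by linarith)
    have h2 : t ^ β ≤ (2 * τ) ^ β := Real.rpow_le_rpow ht0.le ht.2.le hβ0.le
    gcongr
  · exact (hasDerivAt_wrightKernel_right hβ0.le (by linarith) hν (by linarith [ht.1]) _).mul_const _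

lemma contDiff_wrightPotential_space (hβ0 : 0 < β) (hβ : β ≤ 1 / 2) (hc : 0 < c)
    (hf : Continuous f) (hJ : ∀ x, Integrable (fun η => (1 + (x - η) ^ 2)⁻¹ * |f η|))
    {τ : ℝ} (hτ : 0 < τ) :
    ContDiff ℝ 2 (fun x => wrightPotential β c f β x τ) ∧ ∀ x,
      c ^ 2 * iteratedDeriv 2 (fun x => wrightPotential β c f β x τ) x
        = wrightPotential β c f (-β) x τ := by
  have hβ1 : β < 1 := by linarith
  set k : ℝ → ℝ := fun y => wrightKernel β β (|y| / c) τ with hk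
  set k₁ : ℝ → ℝ := fun y => SignType.sign y * (-wrightKernel β 0 (|y| / c) τ / c) with hk₁
  set k₂ : ℝ → ℝ := fun y => wrightKernel β (-β) (|y| / c) τ / c / c with hk₂
  have hd1 : ∀ z : ℝ, HasDerivAt (fun z => wrightKernel β β (z / c) τ)
      (-wrightKernel β 0 (z / c) τ / c) z := fun z => by
    have := (hasDerivAt_wrightKernel_left hβ0.le hβ1 hβ1 hτ (z / c)).comp z
      ((hasDerivAt_id z).div_const c)
    rw [sub_self] at this
    exact this.congr_deriv (by ring)
  have hd2 : ∀ z : ℝ, HasDerivAt (fun z => -wrightKernel β 0 (z / c) τ / c)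
      (wrightKernel β (-β) (z / c) τ / c / c) z := fun z => by
    have := (((hasDerivAt_wrightKernel_left hβ0.le hβ1 one_pos hτ (z / c)).comp z
      ((hasDerivAt_id z).div_const c)).neg).div_const c
    rw [zero_sub] at this
    exact this.congr_deriv (by ring)
  -- The order β - β = 0 makes the slope at the origin a multiple of 1/Γ(0) = 0; this smooths the
  -- kernel at x = η.
  have h00 : -wrightKernel β 0 (0 / c) τ / c = 0 := by
    simp [wrightKernel, wright_zero_left, Real.Gamma_zero]
  have hk01 : ∀ y, HasDerivAt k (k₁ y) y := hasDerivAt_comp_abs hd1 h00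
  have hk12 : ∀ y, HasDerivAt k₁ (k₂ y) y := hasDerivAt_sign_mul_comp_abs hd2 h00
  have hcont1 : Continuous k₁ := continuous_iff_continuousAt.2 fun y => (hk12 y).continuousAt
  have hcont2 : Continuous k₂ :=
    (((continuous_wrightKernel hβ0.le hβ1 (by linarith) hτ).comp
      (by fun_prop : Continuous fun y : ℝ => |y| / c)).div_const c).div_const c
  obtain ⟨C₀, hC₀, hb₀⟩ := exists_abs_wrightKernel_le hβ0 hβ hβ1 hc
  obtain ⟨C₁, hC₁, hb₁⟩ := exists_abs_wrightKernel_le hβ0 hβ one_pos hc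
  obtain ⟨C₂, hC₂, hb₂⟩ := exists_abs_wrightKernel_le hβ0 hβ (show -β < 1 by linarith) hc
  set A₀ := C₀ * (τ ^ (β - 1) * (1 + (τ ^ β) ^ 2)) with hA₀
  set A₁ := C₁ * (τ ^ ((0 : ℝ) - 1) * (1 + (τ ^ β) ^ 2)) / c with hA₁
  set A₂ := C₂ * (τ ^ (-β - 1) * (1 + (τ ^ β) ^ 2)) / c / c with hA₂
  have hA₀' : 0 ≤ A₀ := by positivity
  have hA₁' : 0 ≤ A₁ := by positivity
  have hA₂' : 0 ≤ A₂ := by positivity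
  have hq : ∀ y : ℝ, 0 ≤ (1 + y ^ 2)⁻¹ := fun y => by positivity
  have e0 : ∀ y, |k y| ≤ (A₀ + A₁ + A₂) * (1 + y ^ 2)⁻¹ := fun y =>
    (hb₀ τ hτ y).trans (mul_le_mul_of_nonneg_right (by linarith) (hq y))
  have e1 : ∀ y, |k₁ y| ≤ (A₀ + A₁ + A₂) * (1 + y ^ 2)⁻¹ := fun y => by
    have hs : |((SignType.sign y : SignType) : ℝ)| ≤ 1 := by
      cases SignType.sign y <;> simp
    have h1 : |k₁ y| ≤ 1 * (A₁ * (1 + y ^ 2)⁻¹) := by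
      simp only [hk₁]
      rw [abs_mul, abs_div, abs_neg, abs_of_pos hc, hA₁, div_mul_eq_mul_div]
      gcongr
      exact hb₁ τ hτ y
    rw [one_mul] at h1
    exact h1.trans (mul_le_mul_of_nonneg_right (by linarith) (hq y))
  have e2 : ∀ y, |k₂ y| ≤ (A₀ + A₁ + A₂) * (1 + y ^ 2)⁻¹ := fun y => by
    have h1 : |k₂ y| ≤ A₂ * (1 + y ^ 2)⁻¹ := by
      simp only [hk₂]
      rw [abs_div, abs_div, abs_of_pos hc, hA₂, div_mul_eq_mul_div, div_mul_eq_mul_div]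
      gcongr
      exact hb₂ τ hτ y
    exact h1.trans (mul_le_mul_of_nonneg_right (by linarith) (hq y))
  have hA : 0 ≤ A₀ + A₁ + A₂ := by positivity
  have hD1 : ∀ x, HasDerivAt (fun x => wrightPotential β c f β x τ) (∫ η, k₁ (x - η) * f η) x :=
    hasDerivAt_conv hf hJ hk01 hcont1 hA e0 e1
  have hD2 : ∀ x, HasDerivAt (fun x => ∫ η, k₁ (x - η) * f η) (∫ η, k₂ (x - η) * f η) x :=
    hasDerivAt_conv hf hJ hk12 hcont2 hA e1 e2
  have hcontD : Continuous fun x => ∫ η, k₂ (x - η) * f η :=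
    continuous_conv hf hJ hcont2 hA e2
  have hderiv1 : deriv (fun x => wrightPotential β c f β x τ) = fun x => ∫ η, k₁ (x - η) * f η :=
    funext fun x => (hD1 x).deriv
  have hderiv2 : deriv (fun x => ∫ η, k₁ (x - η) * f η) = fun x => ∫ η, k₂ (x - η) * f η :=
    funext fun x => (hD2 x).deriv
  constructor
  · rw [show (2 : WithTop ℕ∞) = 1 + 1 by norm_num, contDiff_succ_iff_deriv]
    refine ⟨fun x => (hD1 x).differentiableAt, by simp, ?_⟩
    rw [hderiv1, contDiff_one_iff_deriv, hderiv2]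
    exact ⟨fun x => (hD2 x).differentiableAt, hcontD⟩
  · intro x
    rw [iteratedDeriv_succ, iteratedDeriv_one, hderiv1, hderiv2, wrightPotential]
    rw [← integral_const_mul]
    refine integral_congr_ae (Eventually.of_forall fun η => ?_)
    simp only [hk₂]
    field_simp

end Potential

/-! ### Fractional integration of the potential -/

/-- Each half of the interval carries a single endpoint singularity; reflection exchanges the
halves. -/
lemma integrableOn_beta {a b τ : ℝ} (ha : 0 < a) (hb : 0 < b) (hτ : 0 < τ) :
    IntegrableOn (fun σ => (τ - σ) ^ (a - 1) * σ ^ (b - 1)) (Ioo 0 τ) := by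
  have half : ∀ {a b : ℝ}, 0 < b →
      IntervalIntegrable (fun σ => (τ - σ) ^ (a - 1) * σ ^ (b - 1)) volume 0 (τ / 2) := by
    intro a b hb
    refine (intervalIntegral.intervalIntegrable_rpow' (by linarith)).continuousOn_mul ?_
    refine ContinuousOn.rpow_const (by fun_prop) fun σ hσ => Or.inl ?_
    rw [uIcc_of_le (by linarith)] at hσ
    linarith [hσ.2]
  have h2 := (half (a := b) ha).comp_sub_left τ
  simp only [sub_zero, sub_sub_cancel, sub_half] at h2
  have h3 := (half (a := a) hb).trans (c := τ)
    (h2.symm.congr fun σ _ => mul_comm _ _)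
  rw [intervalIntegrable_iff_integrableOn_Ioo_of_le hτ.le] at h3
  exact h3

section

variable {β c : ℝ} {f : ℝ → ℝ}

lemma integrable_prod_rpow_mul_wrightKernel {α ν : ℝ} (hβ0 : 0 < β) (hβ : β ≤ 1 / 2) (hν0 : 0 < ν)
    (hν : ν < 1) (hα : 0 < α) (hc : 0 < c) (hf : Continuous f)
    (hJ : ∀ x, Integrable (fun η => (1 + (x - η) ^ 2)⁻¹ * |f η|)) (x : ℝ) {τ : ℝ} (hτ : 0 < τ) :
    Integrable (Function.uncurry fun σ η : ℝ =>
      (τ - σ) ^ (α - 1) * (wrightKernel β ν (|x - η| / c) σ * f η))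
      ((volume.restrict (Ioo 0 τ)).prod volume) := by
  obtain ⟨C, hC, h⟩ := exists_abs_wrightKernel_le hβ0 hβ hν hc
  refine (((integrableOn_beta hα hν0 hτ).const_mul (C * (1 + (τ ^ β) ^ 2))).mul_prod
    (hJ x)).mono' ?_ ?_
  · refine Measurable.aestronglyMeasurable ?_
    have h1 := measurable_wrightKernel_abs_sub (c := c) hβ0.le (by linarith) hν x
    have h2 : Measurable fun p : ℝ × ℝ => f p.2 := hf.measurable.comp measurable_snd
    have h3 : Measurable fun p : ℝ × ℝ => (τ - p.1) ^ (α - 1) := by fun_prop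
    exact h3.mul (h1.mul h2)
  · filter_upwards [Measure.quasiMeasurePreserving_fst.ae
      (ae_restrict_mem (measurableSet_Ioo (a := 0) (b := τ)))] with p hp
    have hp0 : 0 < p.1 := hp.1
    have hp1 : 0 < τ - p.1 := sub_pos.2 hp.2
    simp only [Function.uncurry]
    rw [norm_mul, norm_mul, Real.norm_of_nonneg (by positivity), Real.norm_eq_abs,
      Real.norm_eq_abs]
    have h1 : p.1 ^ β ≤ τ ^ β := Real.rpow_le_rpow hp0.le hp.2.le hβ0.le
    calc (τ - p.1) ^ (α - 1) * (|wrightKernel β ν (|x - p.2| / c) p.1| * |f p.2|)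
        ≤ (τ - p.1) ^ (α - 1) * ((C * (p.1 ^ (ν - 1) * (1 + (τ ^ β) ^ 2)) *
          (1 + (x - p.2) ^ 2)⁻¹) * |f p.2|) := by
          gcongr
          exact (h _ hp0 _).trans (by gcongr)
      _ = _ := by ring

lemma integrableOn_rpow_mul_wrightPotential {α ν : ℝ} (hβ0 : 0 < β) (hβ : β ≤ 1 / 2) (hν0 : 0 < ν)
    (hν : ν < 1) (hα : 0 < α) (hc : 0 < c) (hf : Continuous f)
    (hJ : ∀ x, Integrable (fun η => (1 + (x - η) ^ 2)⁻¹ * |f η|)) (x : ℝ) {τ : ℝ} (hτ : 0 < τ) :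
    IntegrableOn (fun σ => (τ - σ) ^ (α - 1) * wrightPotential β c f ν x σ) (Ioo 0 τ) := by
  have h := (integrable_prod_rpow_mul_wrightKernel hβ0 hβ hν0 hν hα hc hf hJ x
    hτ).integral_prod_left
  simp only [Function.uncurry, integral_const_mul] at h
  exact h

/-- Riemann–Liouville integration in time of the potential. -/
lemma integral_rpow_mul_wrightPotential {α ν : ℝ} (hβ0 : 0 < β) (hβ : β ≤ 1 / 2) (hν0 : 0 < ν)
    (hν : ν + α < 1) (hα : 0 < α) (hc : 0 < c) (hf : Continuous f)
    (hJ : ∀ x, Integrable (fun η => (1 + (x - η) ^ 2)⁻¹ * |f η|)) (x : ℝ) {τ : ℝ} (hτ : 0 < τ) :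
    ∫ σ in Ioo 0 τ, (τ - σ) ^ (α - 1) * wrightPotential β c f ν x σ
      = Real.Gamma α * wrightPotential β c f (ν + α) x τ := by
  have h := integrable_prod_rpow_mul_wrightKernel hβ0 hβ hν0 (by linarith) hα hc hf hJ x hτ
  simp only [wrightPotential]
  simp_rw [← integral_const_mul]
  rw [integral_integral_swap h]
  refine integral_congr_ae ?_
  -- The rule for the kernel needs r > 0; the excluded point is null.
  have hne : ∀ᵐ η : ℝ, η ≠ x := by simp [ae_iff]
  filter_upwards [hne] with η hη
  simp_rw [← mul_assoc]
  rw [integral_mul_const, integral_rpow_mul_wrightKernel hβ0 hβ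
    (div_pos (abs_pos.2 (sub_ne_zero.2 hη.symm)) hc) hα hν hτ]

/-! ### Approximation of the identity -/

/-- Substitute y = c τ^β z: the prefactor τ^(-β) cancels against the Jacobian and leaves c. -/
lemma integral_wrightKernel_abs (hc : 0 < c) {τ : ℝ} (hτ : 0 < τ)
    (g : ℝ → ℝ) :
    ∫ y, wrightKernel β (1 - β) (|y| / c) τ * g y
      = c * ∫ z, wright (-|z|) (-β) (1 - β) * g (c * τ ^ β * z) := by
  have hT : 0 < τ ^ β := Real.rpow_pos_of_pos hτ β
  have hb : 0 < c * τ ^ β := by positivity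
  have h := Measure.integral_comp_mul_left
    (fun y => wrightKernel β (1 - β) (|y| / c) τ * g y) (c * τ ^ β)
  rw [abs_of_pos (inv_pos.2 hb), smul_eq_mul, eq_inv_mul_iff_mul_eq₀ hb.ne'] at h
  rw [← h, mul_assoc, ← integral_const_mul]
  congr 2
  funext z
  have e1 : |c * τ ^ β * z| / c / τ ^ β = |z| := by
    rw [abs_mul, abs_of_pos hb]
    field_simp
  have e2 : τ ^ β * τ ^ (1 - β - 1) = 1 := by
    rw [← Real.rpow_add hτ]
    simp
  rw [wrightKernel, e1]
  linear_combination (wright (-|z|) (-β) (1 - β) * g (c * τ ^ β * z)) * e2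

lemma integrable_wright_abs (hβ0 : 0 < β) (hβ : β ≤ 1 / 2) :
    Integrable fun z => wright (-|z|) (-β) (1 - β) := by
  obtain ⟨C, hC, h⟩ := exists_abs_wright_le hβ0 hβ (show 1 - β < 1 by linarith)
  refine (integrable_inv_one_add_sq.const_mul C).mono' (Continuous.aestronglyMeasurable
    ((continuous_wright hβ0.le (by linarith) (by linarith)).comp continuous_abs))
    (Eventually.of_forall fun z => ?_)
  have := h |z| (abs_nonneg z)
  rwa [sq_abs] at this

lemma integral_wright_abs (hβ0 : 0 < β) (hβ : β ≤ 1 / 2) :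
    ∫ z, wright (-|z|) (-β) (1 - β) = 2 := by
  rw [integral_comp_abs (f := fun z => wright (-z) (-β) (1 - β)), integral_wright_eq_one hβ0 hβ,
    mul_one]

/-- As `τ → 0`, the kernel of order `1 - β` is an approximation of the identity. -/
lemma tendsto_wrightPotential_zero (hβ0 : 0 < β) (hβ : β ≤ 1 / 2) (hc : 0 < c)
    (hf : Continuous f) (hJ : ∀ x, Integrable (fun η => (1 + (x - η) ^ 2)⁻¹ * |f η|)) (x : ℝ) :
    Tendsto (fun τ => wrightPotential β c f (1 - β) x τ) (𝓝[>] 0) (𝓝 (2 * c * f x)) := by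
  have hν : 1 - β < 1 := by linarith
  obtain ⟨C, hC, h⟩ := exists_abs_wright_le hβ0 hβ hν
  set g : ℝ → ℝ := fun y => f (x - y) - f x with hg
  have hgc : Continuous g := by fun_prop
  -- Near part, bounded and handled by scaling; the far part may be unbounded and is handled by the
  -- decay of the kernel.
  set g₁ : ℝ → ℝ := (Ioo (-1) 1).indicator g with hg₁
  set g₂ : ℝ → ℝ := (Ioo (-1) 1)ᶜ.indicator g with hg₂
  have hgint : Integrable fun y => (1 + y ^ 2)⁻¹ * |g y| := by
    have h1 := (hJ x).comp_sub_left x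
    simp only [sub_sub_cancel] at h1
    refine (h1.add (integrable_inv_one_add_sq.mul_const |f x|)).mono'
      (Continuous.aestronglyMeasurable ((Continuous.inv₀ (by fun_prop)
        fun ξ => by positivity).mul (by fun_prop))) (Eventually.of_forall fun y => ?_)
    rw [Real.norm_of_nonneg (by positivity)]
    simp only [Pi.add_apply, ← mul_add]
    gcongr
    exact abs_sub _ _
  obtain ⟨B, hB⟩ := isCompact_Icc.exists_bound_of_continuousOn (s := Icc (-1 : ℝ) 1) hgc.continuousOn
  have hB0 : 0 ≤ B := (norm_nonneg _).trans (hB 0 (by simp))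
  have hg₁B : ∀ y, ‖g₁ y‖ ≤ B := by
    intro y
    by_cases hy : y ∈ Ioo (-1 : ℝ) 1
    · rw [hg₁, indicator_of_mem hy]
      exact hB y (Ioo_subset_Icc_self hy)
    · rw [hg₁, indicator_of_notMem hy, norm_zero]
      exact hB0
  have hg₁m : Measurable g₁ := hgc.measurable.indicator measurableSet_Ioo
  have hw : Continuous fun z => wright (-|z|) (-β) (1 - β) :=
    (continuous_wright hβ0.le (by linarith) hν).comp continuous_abs
  have hTlim : Tendsto (fun τ : ℝ => τ ^ β) (𝓝[>] 0) (𝓝 0) := by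
    have : ContinuousAt (fun τ : ℝ => τ ^ β) 0 :=
      Real.continuousAt_rpow_const _ _ (Or.inr hβ0.le)
    have h1 := this.tendsto.mono_left (nhdsWithin_le_nhds (s := Ioi 0))
    rwa [Real.zero_rpow hβ0.ne'] at h1
  have lim1 : Tendsto (fun τ => c * ∫ z, wright (-|z|) (-β) (1 - β) * g₁ (c * τ ^ β * z)) (𝓝[>] 0)
      (𝓝 0) := by
    have h0 : Tendsto (fun τ => ∫ z, wright (-|z|) (-β) (1 - β) * g₁ (c * τ ^ β * z)) (𝓝[>] 0)
        (𝓝 (∫ z, wright (-|z|) (-β) (1 - β) * 0)) := by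
      refine tendsto_integral_filter_of_dominated_convergence
        (fun z => ‖wright (-|z|) (-β) (1 - β)‖ * B) (Eventually.of_forall fun τ => ?_)
        (Eventually.of_forall fun τ => Eventually.of_forall fun z => ?_)
        ((integrable_wright_abs hβ0 hβ).norm.mul_const B) (Eventually.of_forall fun z => ?_)
      · exact (hw.measurable.mul (hg₁m.comp (by fun_prop))).aestronglyMeasurable
      · rw [norm_mul]
        gcongr
        exact hg₁B _
      · have hlim : Tendsto (fun τ : ℝ => c * τ ^ β * z) (𝓝[>] 0) (𝓝 0) := by
          simpa using (hTlim.const_mul c).mul_const z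
        have hg₁0 : ContinuousAt g₁ 0 := by
          refine hgc.continuousAt.congr ?_
          filter_upwards [Ioo_mem_nhds (show (-1 : ℝ) < 0 by norm_num) one_pos] with y hy
          rw [hg₁, indicator_of_mem hy]
        have hv : g₁ 0 = 0 := by simp [hg₁, hg]
        have := hg₁0.tendsto.comp hlim
        rw [hv] at this
        exact this.const_mul _
    simpa using h0.const_mul c
  -- The prefactor τ^(-β) times the decay τ^(2β) leaves τ^β. For |y| ≥ 1, 1 + y² ≤ 2y², whence the 2
  -- in 2c².
  have hbound2 : ∀ τ, 0 < τ → ∀ y, |wrightKernel β (1 - β) (|y| / c) τ * g₂ y|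
      ≤ (C * (2 * c ^ 2)) * τ ^ β * ((1 + y ^ 2)⁻¹ * |g y|) := by
    intro τ hτ y
    have hT : 0 < τ ^ β := Real.rpow_pos_of_pos hτ β
    by_cases hy : y ∈ Ioo (-1 : ℝ) 1
    · rw [hg₂, indicator_of_notMem (by simpa using hy), mul_zero, abs_zero]
      positivity
    · rw [hg₂, indicator_of_mem hy, abs_mul, ← mul_assoc]
      gcongr
      have hy1 : 1 ≤ y ^ 2 := by
        rw [one_le_sq_iff_one_le_abs]
        by_contra hcon
        exact hy (abs_lt.1 (not_le.1 hcon))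
      have h1 := h (|y| / c / τ ^ β) (by positivity)
      rw [wrightKernel, abs_mul, abs_of_pos (by positivity)]
      have e2 : τ ^ (1 - β - 1) = (τ ^ β)⁻¹ := by
        rw [← Real.rpow_neg hτ.le]; congr 1; ring
      have h2 : C / (1 + (|y| / c / τ ^ β) ^ 2) ≤ C * (2 * c ^ 2 * (τ ^ β) ^ 2 * (1 + y ^ 2)⁻¹) := by
        rw [div_eq_mul_inv]
        gcongr
        rw [← div_eq_mul_inv, ← one_div, div_le_div_iff₀ (by positivity) (by positivity), div_div,
          div_pow, sq_abs, mul_add, mul_pow]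
        have e3 : 2 * c ^ 2 * (τ ^ β) ^ 2 * (y ^ 2 / (c ^ 2 * (τ ^ β) ^ 2)) = 2 * y ^ 2 := by
          field_simp
        have : 0 ≤ 2 * c ^ 2 * (τ ^ β) ^ 2 * 1 := by positivity
        linarith
      rw [e2]
      calc (τ ^ β)⁻¹ * |wright (-(|y| / c / τ ^ β)) (-β) (1 - β)|
          ≤ (τ ^ β)⁻¹ * (C * (2 * c ^ 2 * (τ ^ β) ^ 2 * (1 + y ^ 2)⁻¹)) := by
            gcongr
            exact h1.trans h2
        _ = _ := by field_simp
  have hkm : ∀ τ, 0 < τ → Continuous fun y : ℝ => wrightKernel β (1 - β) (|y| / c) τ := fun τ hτ =>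
    (continuous_wrightKernel hβ0.le (by linarith) hν hτ).comp
      (by fun_prop : Continuous fun y : ℝ => |y| / c)
  have hint2 : ∀ τ, 0 < τ → Integrable fun y => wrightKernel β (1 - β) (|y| / c) τ * g₂ y :=
    fun τ hτ => (hgint.const_mul _).mono' ((hkm τ hτ).measurable.mul
      (hgc.measurable.indicator measurableSet_Ioo.compl)).aestronglyMeasurable
      (Eventually.of_forall (hbound2 τ hτ))
  have lim2 : Tendsto (fun τ => ∫ y, wrightKernel β (1 - β) (|y| / c) τ * g₂ y) (𝓝[>] 0) (𝓝 0) := by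
    refine squeeze_zero_norm' (a := fun τ => (C * (2 * c ^ 2)) * τ ^ β *
      ∫ y, (1 + y ^ 2)⁻¹ * |g y|) ?_ ?_
    · filter_upwards [self_mem_nhdsWithin] with τ hτ
      rw [← integral_const_mul]
      exact norm_integral_le_of_norm_le (hgint.const_mul _) (Eventually.of_forall (hbound2 τ hτ))
    · simpa using (hTlim.const_mul (C * (2 * c ^ 2))).mul_const (∫ y, (1 + y ^ 2)⁻¹ * |g y|)
  have lim3 := (lim1.add lim2).add_const (2 * c * f x)
  simp only [add_zero, zero_add] at lim3
  refine lim3.congr' ?_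
  filter_upwards [self_mem_nhdsWithin] with τ hτ
  have hτ0 : 0 < τ := hτ
  obtain ⟨C', hC', h'⟩ := exists_abs_wrightKernel_le hβ0 hβ hν hc
  have hkint : Integrable fun y : ℝ => wrightKernel β (1 - β) (|y| / c) τ :=
    (integrable_inv_one_add_sq.const_mul _).mono' (hkm τ hτ0).aestronglyMeasurable
      (Eventually.of_forall (h' τ hτ0))
  have hint1 : Integrable fun y => wrightKernel β (1 - β) (|y| / c) τ * g₁ y :=
    hkint.mul_bdd hg₁m.aestronglyMeasurable (Eventually.of_forall hg₁B)
  have hint12 : Integrable fun y => wrightKernel β (1 - β) (|y| / c) τ * g₁ y +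
      wrightKernel β (1 - β) (|y| / c) τ * g₂ y := hint1.add (hint2 τ hτ0)
  have hmass : ∫ y, wrightKernel β (1 - β) (|y| / c) τ * f x = 2 * c * f x := by
    rw [integral_wrightKernel_abs hc hτ0, integral_mul_const, integral_wright_abs hβ0 hβ]
    ring
  rw [← integral_wrightKernel_abs hc hτ0, ← hmass, ← integral_add hint1 (hint2 τ hτ0),
    ← integral_add hint12 (hkint.mul_const _), wrightPotential,
    ← integral_sub_left_eq_self (fun η => wrightKernel β (1 - β) (|x - η| / c) τ * f η) volume x]
  refine integral_congr_ae (Eventually.of_forall fun y => ?_)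
  have hsplit : g₁ y + g₂ y = f (x - y) - f x := by
    rw [hg₁, hg₂, ← Pi.add_apply, indicator_self_add_compl]
  simp only [sub_sub_cancel]
  linear_combination (wrightKernel β (1 - β) (|y| / c) τ) * hsplit

end

/-! ### The substitution σ = Ψ(s) -/

section TimeChange

variable {Ψ : ℝ → ℝ}

lemma psi_strictMonoOn (hΨcont : ContinuousOn Ψ (Ici 0)) (hΨpos : ∀ t, 0 < t → 0 < deriv Ψ t) :
    StrictMonoOn Ψ (Ici 0) :=
  strictMonoOn_of_deriv_pos (convex_Ici 0) hΨcont fun t ht => hΨpos t (by simpa using ht)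

lemma psi_image_Ioo (hΨ0 : Ψ 0 = 0) (hΨcont : ContinuousOn Ψ (Ici 0))
    (hΨpos : ∀ t, 0 < t → 0 < deriv Ψ t) {t : ℝ} (ht : 0 < t) :
    Ψ '' Ioo 0 t = Ioo 0 (Ψ t) := by
  have hmono := psi_strictMonoOn hΨcont hΨpos
  refine Subset.antisymm ?_ ?_
  · rintro _ ⟨s, hs, rfl⟩
    refine ⟨?_, hmono hs.1.le ht.le hs.2⟩
    rw [← hΨ0]
    exact hmono self_mem_Ici hs.1.le hs.1
  · have := intermediate_value_Ioo ht.le (hΨcont.mono Icc_subset_Ici_self)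
    rwa [hΨ0] at this

lemma psi_pos (hΨ0 : Ψ 0 = 0) (hΨcont : ContinuousOn Ψ (Ici 0))
    (hΨpos : ∀ t, 0 < t → 0 < deriv Ψ t) {t : ℝ} (ht : 0 < t) : 0 < Ψ t := by
  rw [← hΨ0]
  exact psi_strictMonoOn hΨcont hΨpos self_mem_Ici ht.le ht

lemma psi_hasDerivAt (hΨpos : ∀ t, 0 < t → 0 < deriv Ψ t) {t : ℝ} (ht : 0 < t) :
    HasDerivAt Ψ (deriv Ψ t) t :=
  (differentiableAt_of_deriv_ne_zero (hΨpos t ht).ne').hasDerivAt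

lemma psiIntegrand_eq {α : ℝ} {g V : ℝ → ℝ} (hΨpos : ∀ t, 0 < t → 0 < deriv Ψ t)
    (hg : ∀ s, 0 < s → g s = V (Ψ s)) {t : ℝ} :
    EqOn (psiIntegrand Ψ α g t)
      (fun s => |deriv Ψ s| • ((Ψ t - Ψ s) ^ (α - 1) * V (Ψ s))) (Ioo 0 t) := fun s hs => by
  simp only [psiIntegrand, smul_eq_mul]
  rw [hg s hs.1, abs_of_pos (hΨpos s hs.1)]
  ring

lemma intervalIntegrable_psiIntegrand {α : ℝ} {g V : ℝ → ℝ} (hΨ0 : Ψ 0 = 0)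
    (hΨcont : ContinuousOn Ψ (Ici 0)) (hΨpos : ∀ t, 0 < t → 0 < deriv Ψ t)
    (hg : ∀ s, 0 < s → g s = V (Ψ s)) {t : ℝ} (ht : 0 < t)
    (hV : IntegrableOn (fun σ => (Ψ t - σ) ^ (α - 1) * V σ) (Ioo 0 (Ψ t))) :
    IntervalIntegrable (psiIntegrand Ψ α g t) volume 0 t := by
  rw [intervalIntegrable_iff_integrableOn_Ioo_of_le ht.le,
    integrableOn_congr_fun (psiIntegrand_eq hΨpos hg) measurableSet_Ioo]
  rw [← psi_image_Ioo hΨ0 hΨcont hΨpos ht] at hV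
  exact (integrableOn_image_iff_integrableOn_abs_deriv_smul measurableSet_Ioo
    (fun s hs => (psi_hasDerivAt hΨpos hs.1).hasDerivWithinAt)
    ((psi_strictMonoOn hΨcont hΨpos).injOn.mono fun s hs => hs.1.le) _).1 hV

lemma psiIntegral_eq {α : ℝ} (hα : α ≠ 0) {g V : ℝ → ℝ} (hΨ0 : Ψ 0 = 0)
    (hΨcont : ContinuousOn Ψ (Ici 0)) (hΨpos : ∀ t, 0 < t → 0 < deriv Ψ t)
    (hg : ∀ s, 0 < s → g s = V (Ψ s)) {t : ℝ} (ht : 0 < t) :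
    psiIntegral 0 Ψ α g t
      = 1 / Real.Gamma α * ∫ σ in Ioo 0 (Ψ t), (Ψ t - σ) ^ (α - 1) * V σ := by
  rw [psiIntegral, if_neg hα, intervalIntegral.integral_of_le ht.le,
    integral_Ioc_eq_integral_Ioo, setIntegral_congr_fun measurableSet_Ioo
      (psiIntegrand_eq hΨpos hg), ← psi_image_Ioo hΨ0 hΨcont hΨpos ht]
  rw [integral_image_eq_integral_abs_deriv_smul measurableSet_Ioo
    (fun s hs => (psi_hasDerivAt hΨpos hs.1).hasDerivWithinAt)
    ((psi_strictMonoOn hΨcont hΨpos).injOn.mono fun s hs => hs.1.le)]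

lemma hasDerivAt_of_eq_comp_psi {g V : ℝ → ℝ} {V' : ℝ} (hΨpos : ∀ t, 0 < t → 0 < deriv Ψ t)
    (hg : ∀ s, 0 < s → g s = V (Ψ s)) {t : ℝ} (ht : 0 < t) (hV : HasDerivAt V V' (Ψ t)) :
    HasDerivAt g (V' * deriv Ψ t) t := by
  refine (hV.comp t (psi_hasDerivAt hΨpos ht)).congr_of_eventuallyEq ?_
  filter_upwards [Ioi_mem_nhds ht] with s hs
  exact hg s hs

lemma psiD_eq {g V : ℝ → ℝ} {V' : ℝ} (hΨpos : ∀ t, 0 < t → 0 < deriv Ψ t)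
    (hg : ∀ s, 0 < s → g s = V (Ψ s)) {t : ℝ} (ht : 0 < t) (hV : HasDerivAt V V' (Ψ t)) :
    psiD Ψ g t = V' := by
  rw [psiD, (hasDerivAt_of_eq_comp_psi hΨpos hg ht hV).deriv]
  have := (hΨpos t ht).ne'
  field_simp

end TimeChange

lemma diffusionKernel_eq (μ κ : ℝ) (Ψ : ℝ → ℝ) (x t : ℝ) :
    diffusionKernel μ κ Ψ x t
      = 1 / (2 * √κ) * wrightKernel (μ / 2) (μ / 2) (|x| / √κ) (Ψ t) := by
  rw [diffusionKernel, wrightKernel, mul_assoc, div_div]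

end PsiFractional

/-! ### The diffusion problem -/

open PsiFractional in
theorem mainTheorem9 (μ κ : ℝ) (hμ0 : 0 < μ) (hμ1 : μ ≤ 1) (hκ : 0 < κ)
    (Ψ : ℝ → ℝ) (hΨ0 : Ψ 0 = 0) (hΨcont : ContinuousOn Ψ (Ici 0))
    (hΨdiff : ContDiffOn ℝ 1 Ψ (Ioi 0)) (hΨpos : ∀ t, 0 < t → 0 < deriv Ψ t)
    (f : ℝ → ℝ) (hf : Continuous f)
    (hf0 : Tendsto (fun x => ∫ η in x..(x + 1), |f η|) (cocompact ℝ) (𝓝 0)) :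
    (∀ z : ℝ, Summable fun j : ℕ =>
      z ^ j / ((j.factorial : ℝ) * Real.Gamma (-(μ / 2) * j + μ / 2))) ∧
    (∀ x t : ℝ, 0 < t →
      Integrable (fun η => PsiFractional.diffusionKernel μ κ Ψ (x - η) t * f η)) ∧
    PsiFractional.IsDiffusionSolution μ κ Ψ f
      (fun x t => ∫ η, PsiFractional.diffusionKernel μ κ Ψ (x - η) t * f η) := by
  set β := μ / 2 with hβdef
  set c := √κ with hcdef
  have hβ0 : 0 < β := by positivity
  have hβ : β ≤ 1 / 2 := by linarith
  have hβ1 : β < 1 := by linarith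
  have hc : 0 < c := Real.sqrt_pos.2 hκ
  have hc2 : c ^ 2 = κ := Real.sq_sqrt hκ.le
  have hJ := fun x => (inv_one_add_sq_mul_integrable_and_le hf hf0 x).1
  have hJ0 := tendsto_integral_inv_one_add_sq hf hf0
  have hΨp : ∀ t, 0 < t → 0 < Ψ t := fun t ht => psi_pos hΨ0 hΨcont hΨpos ht
  have hker : ∀ x t η, diffusionKernel μ κ Ψ (x - η) t * f η
      = 1 / (2 * c) * (wrightKernel β β (|x - η| / c) (Ψ t) * f η) := fun x t η => by
    rw [diffusionKernel_eq, mul_assoc]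
  have hu : ∀ x t, ∫ η, diffusionKernel μ κ Ψ (x - η) t * f η
      = 1 / (2 * c) * wrightPotential β c f β x (Ψ t) := fun x t => by
    simp_rw [hker]
    rw [integral_const_mul, wrightPotential]
  refine ⟨fun z => ?_, fun x t ht => ?_, ?_⟩
  · simpa using (hasSum_wright hβ0.le hβ1 hβ1 (-z)).summable
  · simp_rw [hker]
    exact (integrable_wrightKernel_mul hβ0 hβ hβ1 hc hf hJ x (hΨp t ht)).const_mul _
  simp_rw [hu]
  set v : ℝ → ℝ → ℝ → ℝ := fun ν x τ => 1 / (2 * c) * wrightPotential β c f ν x τ with hv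
  have hvd : ∀ ν < 1, ∀ x τ, 0 < τ → HasDerivAt (v ν x) (v (ν - 1) x τ) τ := fun ν hν x τ hτ =>
    (hasDerivAt_wrightPotential_time hβ0 hβ hν hc hf hJ x hτ).const_mul _
  have hvint : ∀ α : ℝ, 0 < α → ∀ x τ, 0 < τ →
      IntegrableOn (fun σ => (τ - σ) ^ (α - 1) * v β x σ) (Ioo 0 τ) := fun α hα x τ hτ => by
    refine ((integrableOn_rpow_mul_wrightPotential hβ0 hβ hβ0 hβ1 hα hc hf hJ x hτ).const_mul
      (1 / (2 * c))).congr (Eventually.of_forall fun σ => ?_)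
    simp only [hv]
    ring
  have hvRL : μ < 1 → ∀ x t, 0 < t →
      psiIntegral 0 Ψ (1 - μ) (fun s => v β x (Ψ s)) t = v (1 - β) x (Ψ t) := fun hμ x t ht => by
    rw [psiIntegral_eq (by linarith) hΨ0 hΨcont hΨpos (V := v β x) (fun s _ => rfl) ht]
    have h1 : ∀ σ, (Ψ t - σ) ^ (1 - μ - 1) * v β x σ
        = 1 / (2 * c) * ((Ψ t - σ) ^ (1 - μ - 1) * wrightPotential β c f β x σ) := fun σ => by
      simp only [hv]
      ring
    simp_rw [h1]
    -- As μ = 2β, the raised order β + (1 - μ) is 1 - β, below 1 as required.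
    rw [integral_const_mul, integral_rpow_mul_wrightPotential hβ0 hβ hβ0 (by linarith)
      (by linarith) hc hf hJ x (hΨp t ht), show β + (1 - μ) = 1 - β by rw [hβdef]; ring]
    have := (Real.Gamma_pos_of_pos (show 0 < 1 - μ by linarith)).ne'
    simp only [hv]
    field_simp
  have hvspace : ∀ x t, 0 < t →
      v (-β) x (Ψ t) = κ * iteratedDeriv 2 (fun y => v β y (Ψ t)) x := fun x t ht => by
    obtain ⟨h1, h2⟩ := contDiff_wrightPotential_space hβ0 hβ hc hf hJ (hΨp t ht)
    simp only [hv]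
    rw [iteratedDeriv_const_mul_field, ← h2 x, hc2]
    ring
  have hΨlim : Tendsto Ψ (𝓝[>] 0) (𝓝[>] 0) := by
    refine tendsto_nhdsWithin_iff.2 ⟨?_, ?_⟩
    · have := (hΨcont 0 self_mem_Ici).mono_left (nhdsWithin_mono _ Ioi_subset_Ici_self)
      rwa [hΨ0] at this
    · filter_upwards [self_mem_nhdsWithin] with t ht
      exact hΨp t ht
  have hvinit : ∀ x, Tendsto (fun t => v (1 - β) x (Ψ t)) (𝓝[>] 0) (𝓝 (f x)) := fun x => by
    have h1 := ((tendsto_wrightPotential_zero hβ0 hβ hc hf hJ x).comp hΨlim).const_mul (1 / (2 * c))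
    have h2 : 1 / (2 * c) * (2 * c * f x) = f x := by field_simp
    rwa [h2] at h1
  have hcontDiff : ∀ t, 0 < t → ContDiff ℝ 2 (fun x => v β x (Ψ t)) := fun t ht =>
    contDiff_const.mul (contDiff_wrightPotential_space hβ0 hβ hc hf hJ (hΨp t ht)).1
  have hvan : ∀ t, 0 < t → Tendsto (fun x => v β x (Ψ t)) (cocompact ℝ) (𝓝 0) := fun t ht => by
    have h1 := (tendsto_wrightPotential_cocompact hβ0 hβ hβ1 hc hJ hJ0 (hΨp t ht)).const_mul
      (1 / (2 * c))
    rwa [mul_zero] at h1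
  -- For μ < 1, m = 1 and a single time derivative takes order 1 - β to -β. At μ = 1 the floor
  -- jumps, so m = 2: the first derivative undoes the plain integral, and the second takes order β =
  -- 1/2 to β - 1 = -β.
  rcases lt_or_eq_of_le hμ1 with hμ | hμ
  · have hfl : ⌊μ⌋₊ = 0 := Nat.floor_eq_zero.2 hμ
    have horder : ((⌊μ⌋₊ : ℝ) + 1 - μ) = 1 - μ := by rw [hfl]; simp
    refine ⟨fun x t ht => ⟨?_, fun k hk => ?_⟩, hcontDiff, fun x t ht => ?_, hvan, fun x => ?_⟩
    · rw [horder]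
      exact intervalIntegrable_psiIntegrand hΨ0 hΨcont hΨpos (V := v β x) (fun s _ => rfl) ht
        (hvint _ (by linarith) x _ (hΨp t ht))
    · rw [hfl] at hk
      rw [Nat.le_zero.1 hk, horder]
      exact (hasDerivAt_of_eq_comp_psi hΨpos (V := v (1 - β) x) (hvRL hμ x) ht
        (hvd _ (by linarith) x _ (hΨp t ht))).differentiableAt
    · rw [psiRLDeriv, horder, hfl]
      refine (psiD_eq hΨpos (V := v (1 - β) x) (hvRL hμ x) ht
        (hvd _ (by linarith) x _ (hΨp t ht))).trans ?_
      rw [show 1 - β - 1 = -β by ring]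
      exact hvspace x t ht
    · refine (hvinit x).congr' ?_
      filter_upwards [self_mem_nhdsWithin] with t ht
      exact (hvRL hμ x t ht).symm
  · have hfl : ⌊μ⌋₊ = 1 := by simp [hμ]
    have horder : ((⌊μ⌋₊ : ℝ) + 1 - μ) = 1 := by rw [hfl, hμ]; norm_num
    have hβh : β = 1 / 2 := by rw [hβdef, hμ]
    have hvint1 : ∀ x τ, 0 < τ → IntervalIntegrable (v β x) volume 0 τ := fun x τ hτ => by
      rw [intervalIntegrable_iff_integrableOn_Ioo_of_le hτ.le]
      simpa using hvint 1 one_pos x τ hτ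
    have hI : ∀ x s, 0 < s → psiIntegral 0 Ψ 1 (fun s => v β x (Ψ s)) s
        = (fun τ => ∫ σ in 0..τ, v β x σ) (Ψ s) := fun x s hs => by
      rw [psiIntegral_eq one_ne_zero hΨ0 hΨcont hΨpos (V := v β x) (fun s _ => rfl) hs]
      simp [intervalIntegral.integral_of_le (hΨp s hs).le, integral_Ioc_eq_integral_Ioo]
    have hFTC : ∀ x τ, 0 < τ → HasDerivAt (fun τ => ∫ σ in 0..τ, v β x σ) (v β x τ) τ := by
      intro x τ hτ
      have hco : ContinuousOn (v β x) (Ioi 0) := fun σ hσ =>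
        (hvd β hβ1 x σ hσ).continuousAt.continuousWithinAt
      exact intervalIntegral.integral_hasDerivAt_right (hvint1 x τ hτ)
        (hco.stronglyMeasurableAtFilter isOpen_Ioi τ hτ) (hvd β hβ1 x τ hτ).continuousAt
    have hD : ∀ x s, 0 < s → psiD Ψ (psiIntegral 0 Ψ 1 (fun s => v β x (Ψ s))) s = v β x (Ψ s) :=
      fun x s hs => psiD_eq hΨpos (hI x) hs (hFTC x _ (hΨp s hs))
    refine ⟨fun x t ht => ⟨?_, fun k hk => ?_⟩, hcontDiff, fun x t ht => ?_, hvan, fun x => ?_⟩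
    · rw [horder]
      exact intervalIntegrable_psiIntegrand hΨ0 hΨcont hΨpos (V := v β x) (fun s _ => rfl) ht
        (hvint _ one_pos x _ (hΨp t ht))
    · rw [hfl] at hk
      rw [horder]
      interval_cases k
      · exact (hasDerivAt_of_eq_comp_psi hΨpos (hI x) ht (hFTC x _ (hΨp t ht))).differentiableAt
      · exact (hasDerivAt_of_eq_comp_psi hΨpos (hD x) ht
          (hvd β hβ1 x _ (hΨp t ht))).differentiableAt
    · rw [psiRLDeriv, horder, hfl]
      refine (psiD_eq hΨpos (hD x) ht (hvd β hβ1 x _ (hΨp t ht))).trans ?_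
      rw [show β - 1 = -β by rw [hβh]; norm_num]
      exact hvspace x t ht
    -- At μ = 1 the operator I^0 is the identity and 1 - β = β, so the limit concerns u itself.
    · have h1 := hvinit x
      rw [show 1 - β = β by rw [hβh]; norm_num] at h1
      refine h1.congr fun t => ?_
      rw [psiIntegral, if_pos (by rw [hμ, sub_self])]
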